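/- Let $A$ and $B$ be completely contractive Banach algebras, that is, norm-closed operator spaces $A\subseteq B(H)$, $B\subseteq B(K)$ (with the matrix norms inherited from $M_n(B(H))=B(\ell^2_n(H))$ and $M_n(B(K))$), each equipped with an associative bilinear multiplication, not necessarily the one of $B(H)$ or $B(K)$ and not necessarily unital, that is jointly completely contractive: $\|[a_{ij}a'_{kl}]_{(i,k),(j,l)}\|\le\|[a_{ij}]\|\,\|[a'_{kl}]\|$ for all $n$ and all $n\times n$ matrices. (Operator algebras, i.e. closed subalgebras of $B(H)$, are examples.) Let $A\widehat{\otimes}B$ be the completion of the algebraic tensor product $A\otimes B$ in the operator space projective norm $$\|u\|_\wedge=\inf\{\|\alpha\|\,\|x\|\,\|y\|\,\|\beta\| : u=\alpha(x\otimes y)\beta,\ \alpha\in M_{1,pq},\ x\in M_p(A),\ y\in M_q(B),\ \beta\in M_{pq,1},\ p,q\in\mathbb N\},$$ and let $A\otimes^hB$ be its completion in the Haagerup norm $$\|u\|_h=\inf\{\|x\|\,\|y\| : u=\sum_{k=1}^r x_{1k}\otimes y_{k1},\ x\in M_{1,r}(A),\ y\in M_{r,1}(B),\ r\in\mathbb N\}.$$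 Both are Banach algebras for $(a\otimes b)(c\otimes d)=ac\otimes bd$. A Banach algebra $C$ is called Arens regular if its two Arens products on $C^{**}$, $(F\,\square\,G)(f)=F(b\mapsto G(a\mapsto f(ba)))$ and $(F\lozenge G)(f)=G(b\mapsto F(a\mapsto f(ab)))$ for $f\in C^*$, coincide. Suppose that the multiplications of $A$ and of $B$ are not trivial, i.e. there are $a,a'\in A$ with $aa'\neq0$ and $b,b'\in B$ with $bb'\neq0$. (1) If $A\widehat{\otimes}B$ is Arens regular, then $A$ and $B$ are Arens regular. (2) If $A\otimes^hB$ is Arens regular, then $A$ and $B$ are Arens regular. -/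

import Mathlib

open scoped TensorProduct

noncomputable section

set_option linter.unusedSectionVars false

namespace OperatorSpace

section MatrixNorm

variable {H : Type*} [NormedAddCommGroup H] [InnerProductSpace ℂ H]
variable {m n p q : Type*} [Fintype m] [Fintype n] [Fintype p] [Fintype q]

/-- The operator from `ℓ²(n; H)` to `ℓ²(m; H)` given by a matrix `T` of operators on `H`:
`(T ξ) i = ∑ k, T i k (ξ k)`. -/
def blockOp (T : Matrix m n (H →L[ℂ] H)) :
    PiLp 2 (fun _ : n => H) →L[ℂ] PiLp 2 (fun _ : m => H) :=
  (PiLp.continuousLinearEquiv 2 ℂ (fun _ : m => H)).symm.toContinuousLinearMap ∘L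
    ContinuousLinearMap.pi fun i => ∑ k, T i k ∘L PiLp.proj 2 (fun _ : n => H) k

theorem blockOp_apply (T : Matrix m n (H →L[ℂ] H)) (ξ : PiLp 2 (fun _ : n => H)) (i : m) :
    blockOp T ξ i = ∑ k, T i k (ξ k) := by
  simp [blockOp]

variable {X : Type*} [NormedAddCommGroup X] [NormedSpace ℂ X]

/-- The norm of an `m × n` matrix over an operator space `j : X → B(H)`: the operator norm of the
matrix as an operator from `ℓ²(n; H)` to `ℓ²(m; H)`. -/
def matNorm (j : X →ₗᵢ[ℂ] (H →L[ℂ] H)) (x : Matrix m n X) : ℝ :=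
  ‖blockOp (x.map j)‖

variable (j : X →ₗᵢ[ℂ] (H →L[ℂ] H))

theorem matNorm_nonneg (x : Matrix m n X) : 0 ≤ matNorm j x :=
  norm_nonneg (blockOp (x.map j))

theorem matNorm_bound (x : Matrix m n X) (ξ : n → H) :
    ∑ i, ‖∑ k, j (x i k) (ξ k)‖ ^ 2 ≤ matNorm j x ^ 2 * ∑ k, ‖ξ k‖ ^ 2 := by
  have h := (blockOp (x.map j)).le_opNorm (WithLp.toLp 2 ξ)
  have h2 := pow_le_pow_left₀ (norm_nonneg _) h 2
  rw [mul_pow, PiLp.norm_sq_eq_of_L2, PiLp.norm_sq_eq_of_L2] at h2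
  simpa [blockOp_apply, matNorm] using h2

theorem matNorm_le (x : Matrix m n X) {c : ℝ} (hc : 0 ≤ c)
    (h : ∀ ξ : n → H, ∑ i, ‖∑ k, j (x i k) (ξ k)‖ ^ 2 ≤ c ^ 2 * ∑ k, ‖ξ k‖ ^ 2) :
    matNorm j x ≤ c := by
  refine ContinuousLinearMap.opNorm_le_bound _ hc fun ξ => ?_
  refine le_of_sq_le_sq ?_ (by positivity)
  rw [mul_pow, PiLp.norm_sq_eq_of_L2, PiLp.norm_sq_eq_of_L2]
  simpa [blockOp_apply] using h ξ

theorem matNorm_smul_le (c : ℂ) (x : Matrix m n X) :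
    matNorm j (c • x) ≤ ‖c‖ * matNorm j x := by
  refine matNorm_le j _ (mul_nonneg (norm_nonneg _) (matNorm_nonneg j x)) fun ξ => ?_
  have h := mul_le_mul_of_nonneg_left (matNorm_bound j x ξ) (sq_nonneg ‖c‖)
  simpa [← Finset.smul_sum, norm_smul, mul_pow, ← Finset.mul_sum, mul_assoc] using h

theorem matNorm_submatrix_le (x : Matrix m n X) {f : p → m} {g : q → n}
    (hf : Function.Injective f) (hg : Function.Injective g) :
    matNorm j (x.submatrix f g) ≤ matNorm j x := by
  refine matNorm_le j _ (matNorm_nonneg j x) fun ξ => ?_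
  have h1 : ∀ i, ∑ k, j (x i (g k)) (ξ k) =
      ∑ k, j (x i k) (Function.extend g ξ 0 k) := fun i =>
    Fintype.sum_of_injective g hg _ _
      (fun k hk => by rw [Function.extend_apply' _ _ _ (by simpa using hk)]; simp)
      (fun k => by rw [hg.extend_apply])
  have h2 : ∑ k, ‖ξ k‖ ^ 2 = ∑ k, ‖Function.extend g ξ 0 k‖ ^ 2 :=
    Fintype.sum_of_injective g hg _ _
      (fun k hk => by rw [Function.extend_apply' _ _ _ (by simpa using hk)]; simp)
      (fun k => by rw [hg.extend_apply])
  simp only [Matrix.submatrix_apply, h1]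
  rw [h2]
  refine le_trans ?_ (matNorm_bound j x _)
  have := Fintype.sum_of_injective f hf
    (fun i => ‖∑ k, j (x (f i) k) (Function.extend g ξ 0 k)‖ ^ 2)
    (Set.indicator (Set.range f) fun i => ‖∑ k, j (x i k) (Function.extend g ξ 0 k)‖ ^ 2)
    (fun i hi => by rw [Set.indicator_of_notMem hi]) (fun i => by simp)
  rw [this]
  exact Finset.sum_le_sum fun i _ => Set.indicator_le_self' (fun _ _ => by positivity) i

theorem matNorm_fromBlocks_diag_le (x : Matrix m n X) (y : Matrix p q X) {c : ℝ}
    (hx : matNorm j x ≤ c) (hy : matNorm j y ≤ c) :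
    matNorm j (Matrix.fromBlocks x 0 0 y) ≤ c := by
  have hc := (matNorm_nonneg j x).trans hx
  refine matNorm_le j _ hc fun ξ => ?_
  have h1 := matNorm_bound j x fun k => ξ (Sum.inl k)
  have h2 := matNorm_bound j y fun k => ξ (Sum.inr k)
  have h3 : matNorm j x ^ 2 ≤ c ^ 2 := pow_le_pow_left₀ (matNorm_nonneg j x) hx 2
  have h4 : matNorm j y ^ 2 ≤ c ^ 2 := pow_le_pow_left₀ (matNorm_nonneg j y) hy 2
  simp only [Fintype.sum_sum_type, Matrix.fromBlocks_apply₁₁, Matrix.fromBlocks_apply₁₂,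
    Matrix.fromBlocks_apply₂₁, Matrix.fromBlocks_apply₂₂, Matrix.zero_apply, map_zero,
    zero_apply, Finset.sum_const_zero, add_zero, zero_add, mul_add]
  gcongr
  · exact h1.trans (by gcongr)
  · exact h2.trans (by gcongr)

theorem matNorm_fromCols_sq_le (x : Matrix m n X) (y : Matrix m q X) :
    matNorm j (Matrix.fromCols x y) ^ 2 ≤ matNorm j x ^ 2 + matNorm j y ^ 2 := by
  have hs : 0 ≤ matNorm j x ^ 2 + matNorm j y ^ 2 := by positivity
  rw [← Real.sq_sqrt hs]
  refine pow_le_pow_left₀ (matNorm_nonneg j _) (matNorm_le j _ (Real.sqrt_nonneg _) fun ξ => ?_) 2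
  rw [Real.sq_sqrt hs]
  set s := ∑ k, ‖ξ (Sum.inl k)‖ ^ 2
  set t := ∑ k, ‖ξ (Sum.inr k)‖ ^ 2
  have hs0 : 0 ≤ s := by positivity
  have ht0 : 0 ≤ t := by positivity
  set u : PiLp 2 (fun _ : m => H) := blockOp (x.map j) (WithLp.toLp 2 fun k => ξ (Sum.inl k))
  set v : PiLp 2 (fun _ : m => H) := blockOp (y.map j) (WithLp.toLp 2 fun k => ξ (Sum.inr k))
  have hu : ‖u‖ ^ 2 ≤ matNorm j x ^ 2 * s := by
    rw [PiLp.norm_sq_eq_of_L2]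
    simpa [u, blockOp_apply] using matNorm_bound j x fun k => ξ (Sum.inl k)
  have hv : ‖v‖ ^ 2 ≤ matNorm j y ^ 2 * t := by
    rw [PiLp.norm_sq_eq_of_L2]
    simpa [v, blockOp_apply] using matNorm_bound j y fun k => ξ (Sum.inr k)
  have huv : ∑ i, ‖∑ k, j (Matrix.fromCols x y i k) (ξ k)‖ ^ 2 = ‖u + v‖ ^ 2 := by
    rw [PiLp.norm_sq_eq_of_L2]
    simp [u, v, blockOp_apply, Fintype.sum_sum_type]
  have hst : ∑ k, ‖ξ k‖ ^ 2 = s + t := by simp [s, t, Fintype.sum_sum_type]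
  rw [huv, hst]
  have h1 : ‖u‖ ≤ matNorm j x * √s := by
    refine le_of_sq_le_sq ?_ (mul_nonneg (matNorm_nonneg j x) (Real.sqrt_nonneg _))
    rwa [mul_pow, Real.sq_sqrt hs0]
  have h2 : ‖v‖ ≤ matNorm j y * √t := by
    refine le_of_sq_le_sq ?_ (mul_nonneg (matNorm_nonneg j y) (Real.sqrt_nonneg _))
    rwa [mul_pow, Real.sq_sqrt ht0]
  have h3 : ‖u + v‖ ≤ matNorm j x * √s + matNorm j y * √t := (norm_add_le u v).trans (by gcongr)
  have h4 := pow_le_pow_left₀ (norm_nonneg _) h3 2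
  have h5 := Real.sq_sqrt hs0
  have h6 := Real.sq_sqrt ht0
  nlinarith [sq_nonneg (matNorm j x * √t - matNorm j y * √s)]

theorem matNorm_fromRows_sq_le (x : Matrix m n X) (y : Matrix p n X) :
    matNorm j (Matrix.fromRows x y) ^ 2 ≤ matNorm j x ^ 2 + matNorm j y ^ 2 := by
  have hs : 0 ≤ matNorm j x ^ 2 + matNorm j y ^ 2 := by positivity
  rw [← Real.sq_sqrt hs]
  refine pow_le_pow_left₀ (matNorm_nonneg j _) (matNorm_le j _ (Real.sqrt_nonneg _) fun ξ => ?_) 2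
  rw [Real.sq_sqrt hs, add_mul]
  simpa [Fintype.sum_sum_type] using add_le_add (matNorm_bound j x ξ) (matNorm_bound j y ξ)

end MatrixNorm

section Algebra

variable {H : Type*} [NormedAddCommGroup H] [InnerProductSpace ℂ H]
variable {A : Type*} [NonUnitalNormedRing A] [NormedSpace ℂ A]

/-- An operator space `j : A → B(H)` with an associative multiplication is a completely contractive
Banach algebra (once `A` is complete) if the multiplication is jointly completely contractive. -/
class IsCompletelyContractiveAlgebra (j : A →ₗᵢ[ℂ] (H →L[ℂ] H)) : Prop where
  matNorm_kronecker_le : ∀ (n : ℕ) (a b : Matrix (Fin n) (Fin n) A),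
    matNorm j (Matrix.kroneckerMap (· * ·) a b) ≤ matNorm j a * matNorm j b

variable (j : A →ₗᵢ[ℂ] (H →L[ℂ] H))

/-- The zero-padding of an `m × n` matrix in a corner of a square matrix. -/
def padLeft {m n : Type*} (r : Type*) (a : Matrix m n A) :
    Matrix ((m ⊕ n) ⊕ r) ((m ⊕ n) ⊕ r) A :=
  Matrix.fromBlocks (Matrix.fromBlocks 0 a 0 0) 0 0 0

theorem matNorm_zero {m n : Type*} [Fintype m] [Fintype n] :
    matNorm j (0 : Matrix m n A) = 0 :=
  le_antisymm (matNorm_le j _ le_rfl fun ξ => by simp) (matNorm_nonneg j _)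

theorem matNorm_corner_le {m n r : Type*} [Fintype m] [Fintype n] [Fintype r] (a : Matrix m n A) :
    matNorm j (padLeft r a) ≤ matNorm j a := by
  refine matNorm_fromBlocks_diag_le j _ _ ?_ ((matNorm_zero j).trans_le (matNorm_nonneg j a))
  have h : (Matrix.fromBlocks 0 a 0 0 : Matrix (m ⊕ n) (m ⊕ n) A) =
      (Matrix.fromBlocks a (0 : Matrix m m A) (0 : Matrix n n A) 0).submatrix id Sum.swap := by
    ext i k
    rcases i with i | i <;> rcases k with k | k <;> rfl
  rw [h]
  refine (matNorm_submatrix_le j _ Function.injective_id Sum.swap_leftInverse.injective).trans ?_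
  exact matNorm_fromBlocks_diag_le j _ _ le_rfl ((matNorm_zero j).trans_le (matNorm_nonneg j a))

theorem matNorm_kronecker_le' [IsCompletelyContractiveAlgebra j]
    {m n p q : Type*} [Fintype m] [Fintype n] [Fintype p] [Fintype q]
    (a : Matrix m n A) (b : Matrix p q A) :
    matNorm j (Matrix.kroneckerMap (· * ·) a b) ≤ matNorm j a * matNorm j b := by
  let S := (m ⊕ n) ⊕ (p ⊕ q)
  let S' := (p ⊕ q) ⊕ (m ⊕ n)
  let e : S ≃ Fin (Fintype.card S) := Fintype.equivFin S
  let e' : S' ≃ Fin (Fintype.card S) := (Equiv.sumComm _ _).trans e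
  let a' : Matrix (Fin (Fintype.card S)) (Fin (Fintype.card S)) A :=
    (padLeft (p ⊕ q) a).submatrix e.symm e.symm
  let b' : Matrix (Fin (Fintype.card S)) (Fin (Fintype.card S)) A :=
    (padLeft (m ⊕ n) b).submatrix e'.symm e'.symm
  have ha : matNorm j a' ≤ matNorm j a :=
    (matNorm_submatrix_le j _ e.symm.injective e.symm.injective).trans (matNorm_corner_le j a)
  have hb : matNorm j b' ≤ matNorm j b :=
    (matNorm_submatrix_le j _ e'.symm.injective e'.symm.injective).trans (matNorm_corner_le j b)
  have h : Matrix.kroneckerMap (· * ·) a b =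
      (Matrix.kroneckerMap (· * ·) a' b').submatrix
        (Prod.map (fun i : m => e (Sum.inl (Sum.inl i))) (fun i : p => e' (Sum.inl (Sum.inl i))))
        (Prod.map (fun i : n => e (Sum.inl (Sum.inr i)))
          (fun i : q => e' (Sum.inl (Sum.inr i)))) := by
    ext ⟨i, i'⟩ ⟨k, k'⟩
    simp [a', b', padLeft]
  rw [h]
  refine (matNorm_submatrix_le j _ ?_ ?_).trans
    ((IsCompletelyContractiveAlgebra.matNorm_kronecker_le _ a' b').trans ?_)
  · exact (e.injective.comp (Sum.inl_injective.comp Sum.inl_injective)).prodMap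
      (e'.injective.comp (Sum.inl_injective.comp Sum.inl_injective))
  · exact (e.injective.comp (Sum.inl_injective.comp Sum.inr_injective)).prodMap
      (e'.injective.comp (Sum.inl_injective.comp Sum.inr_injective))
  · exact mul_le_mul ha hb (matNorm_nonneg j _) (matNorm_nonneg j _)

/-- A subalgebra of `B(H)` (an operator algebra) has a completely contractive multiplication. -/
theorem isCompletelyContractiveAlgebra_of_map_mul
    (hj : ∀ a b : A, j (a * b) = j a ∘L j b) : IsCompletelyContractiveAlgebra j := by
  refine ⟨fun n a b => ?_⟩
  refine matNorm_le j _ (mul_nonneg (matNorm_nonneg j a) (matNorm_nonneg j b)) fun ξ => ?_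
  simp only [Fintype.sum_prod_type, Matrix.kroneckerMap_apply, hj,
    ContinuousLinearMap.comp_apply, ← map_sum]
  have h1 : ∀ i', ∑ i, ‖∑ k, j (a i k) (∑ k', j (b i' k') (ξ (k, k')))‖ ^ 2 ≤
      matNorm j a ^ 2 * ∑ k, ‖∑ k', j (b i' k') (ξ (k, k'))‖ ^ 2 := fun i' =>
    matNorm_bound j a _
  have h2 : ∀ k, ∑ i', ‖∑ k', j (b i' k') (ξ (k, k'))‖ ^ 2 ≤
      matNorm j b ^ 2 * ∑ k', ‖ξ (k, k')‖ ^ 2 := fun k => matNorm_bound j b _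
  rw [Finset.sum_comm]
  refine (Finset.sum_le_sum fun i' _ => h1 i').trans ?_
  rw [← Finset.mul_sum, Finset.sum_comm, mul_pow, mul_assoc]
  refine mul_le_mul_of_nonneg_left ?_ (sq_nonneg _)
  rw [Finset.mul_sum]
  exact Finset.sum_le_sum fun k _ => h2 k

end Algebra
section TensorNorms

variable {H K : Type*} [NormedAddCommGroup H] [InnerProductSpace ℂ H]
  [NormedAddCommGroup K] [InnerProductSpace ℂ K]
variable {X Y : Type*} [NormedAddCommGroup X] [NormedSpace ℂ X]
  [NormedAddCommGroup Y] [NormedSpace ℂ Y]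

section Expressions

variable {m n p q : Type*} [Fintype m] [Fintype n] [Fintype p] [Fintype q]

/-- The element `α (x ⊗ y) β` of `X ⊗ Y`, where `x ⊗ y` is the matrix with the entry
`x i j ⊗ y k l` in row `(i, k)` and column `(j, l)`, `α` is a row and `β` a column. -/
def contract (α : EuclideanSpace ℂ (m × p)) (x : Matrix m n X) (y : Matrix p q Y)
    (β : EuclideanSpace ℂ (n × q)) : X ⊗[ℂ] Y :=
  ∑ r : m × p, ∑ c : n × q, (α r * β c) • (x r.1 c.1 ⊗ₜ[ℂ] y r.2 c.2)

/-- The element `∑ k, x 1k ⊗ y k1` of `X ⊗ Y`, for a row `x` and a column `y`. -/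
def rowCol (x : Matrix (Fin 1) n X) (y : Matrix n (Fin 1) Y) : X ⊗[ℂ] Y :=
  ∑ k, x 0 k ⊗ₜ[ℂ] y k 0

end Expressions

/-- The operator space projective norm
`inf {‖α‖ ‖x‖ ‖y‖ ‖β‖ : u = α (x ⊗ y) β, x ∈ M_p(X), y ∈ M_q(Y), α ∈ M_{1,pq}, β ∈ M_{pq,1}}`.
The operator norm of a scalar row or column is its Euclidean norm. -/
def projNorm (j : X →ₗᵢ[ℂ] (H →L[ℂ] H)) (k : Y →ₗᵢ[ℂ] (K →L[ℂ] K)) (u : X ⊗[ℂ] Y) : ℝ :=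
  sInf {t : ℝ | ∃ (p q : ℕ) (α : EuclideanSpace ℂ (Fin p × Fin q))
    (x : Matrix (Fin p) (Fin p) X) (y : Matrix (Fin q) (Fin q) Y)
    (β : EuclideanSpace ℂ (Fin p × Fin q)),
    u = contract α x y β ∧ t = ‖α‖ * matNorm j x * matNorm k y * ‖β‖}

/-- The Haagerup norm `inf {‖x‖ ‖y‖ : u = x ⊙ y, x ∈ M_{1,r}(X), y ∈ M_{r,1}(Y)}`. -/
def haagerupNorm (j : X →ₗᵢ[ℂ] (H →L[ℂ] H)) (k : Y →ₗᵢ[ℂ] (K →L[ℂ] K)) (u : X ⊗[ℂ] Y) : ℝ :=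
  sInf {t : ℝ | ∃ (r : ℕ) (x : Matrix (Fin 1) (Fin r) X) (y : Matrix (Fin r) (Fin 1) Y),
    u = rowCol x y ∧ t = matNorm j x * matNorm k y}

variable (j : X →ₗᵢ[ℂ] (H →L[ℂ] H)) (k : Y →ₗᵢ[ℂ] (K →L[ℂ] K))

/-! ### The Haagerup norm is a seminorm -/

theorem haagerupNorm_nonneg (u : X ⊗[ℂ] Y) : 0 ≤ haagerupNorm j k u := by
  refine Real.sInf_nonneg ?_
  rintro t ⟨r, x, y, -, rfl⟩
  exact mul_nonneg (matNorm_nonneg j x) (matNorm_nonneg k y)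

theorem haagerupNorm_rowCol_le {n : Type*} [Fintype n] (x : Matrix (Fin 1) n X)
    (y : Matrix n (Fin 1) Y) : haagerupNorm j k (rowCol x y) ≤ matNorm j x * matNorm k y := by
  let e := (Fintype.equivFin n).symm
  have key : haagerupNorm j k (rowCol x y) ≤
      matNorm j (x.submatrix id e) * matNorm k (y.submatrix e id) := by
    refine csInf_le ⟨0, ?_⟩ ⟨Fintype.card n, x.submatrix id e, y.submatrix e id, ?_, rfl⟩
    · rintro t ⟨r, x, y, -, rfl⟩
      exact mul_nonneg (matNorm_nonneg j x) (matNorm_nonneg k y)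
    · exact (Equiv.sum_comp e fun i => x 0 i ⊗ₜ[ℂ] y i 0).symm
  · exact key.trans <| mul_le_mul (matNorm_submatrix_le j x Function.injective_id e.injective)
      (matNorm_submatrix_le k y e.injective Function.injective_id) (matNorm_nonneg k _)
      (matNorm_nonneg j _)

theorem rowCol_add {m n : Type*} [Fintype m] [Fintype n] (x : Matrix (Fin 1) m X)
    (y : Matrix m (Fin 1) Y) (x' : Matrix (Fin 1) n X) (y' : Matrix n (Fin 1) Y) :
    rowCol x y + rowCol x' y' = rowCol (Matrix.fromCols x x') (Matrix.fromRows y y') := by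
  simp [rowCol, Fintype.sum_sum_type]

theorem exists_rowCol (u : X ⊗[ℂ] Y) :
    ∃ (r : ℕ) (x : Matrix (Fin 1) (Fin r) X) (y : Matrix (Fin r) (Fin 1) Y), u = rowCol x y := by
  obtain ⟨r, f, g, h⟩ : ∃ (r : ℕ) (f : Fin r → X) (g : Fin r → Y),
      u = ∑ i, f i ⊗ₜ[ℂ] g i := by
    obtain ⟨S, hS⟩ := TensorProduct.exists_finset u
    refine ⟨S.card, fun i => (S.equivFin.symm i).1.1, fun i => (S.equivFin.symm i).1.2, ?_⟩
    rw [Equiv.sum_comp S.equivFin.symm fun i : S => i.1.1 ⊗ₜ[ℂ] i.1.2, hS]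
    exact (Finset.sum_coe_sort S fun i => i.1 ⊗ₜ[ℂ] i.2).symm
  exact ⟨r, fun _ i => f i, fun i _ => g i, h⟩

/-- Two nonnegative numbers can be balanced by a scaling, up to `ε`. -/
theorem exists_balance {a b s : ℝ} (ha : 0 ≤ a) (hb : 0 ≤ b) (h : a * b < s) :
    ∃ t : ℝ, 0 < t ∧ (t * a) ^ 2 ≤ s ∧ (t⁻¹ * b) ^ 2 ≤ s := by
  have hc : Filter.Tendsto (fun δ : ℝ => (a + δ) * (b + δ)) (nhdsWithin 0 (Set.Ioi 0))
      (nhds (a * b)) := by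
    have : Continuous fun δ : ℝ => (a + δ) * (b + δ) := by fun_prop
    simpa using (this.tendsto 0).mono_left nhdsWithin_le_nhds
  obtain ⟨δ, hδs, hδ⟩ := ((hc.eventually_lt_const h).and self_mem_nhdsWithin).exists
  have hδ : 0 < δ := hδ
  have h1 : 0 < a + δ := by linarith
  have h2 : 0 < b + δ := by linarith
  have h3 : √((b + δ) / (a + δ)) ^ 2 = (b + δ) / (a + δ) := Real.sq_sqrt (by positivity)
  refine ⟨√((b + δ) / (a + δ)), by positivity, ?_, ?_⟩
  · rw [mul_pow, h3]
    refine le_trans ?_ hδs.le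
    rw [div_mul_eq_mul_div, div_le_iff₀ h1]
    nlinarith [mul_le_mul (show a ≤ a + δ by linarith) (show a ≤ a + δ by linarith) ha h1.le]
  · rw [mul_pow, inv_pow, h3, inv_div]
    refine le_trans ?_ hδs.le
    rw [div_mul_eq_mul_div, div_le_iff₀ h2]
    nlinarith [mul_le_mul (show b ≤ b + δ by linarith) (show b ≤ b + δ by linarith) hb h2.le]

theorem exists_rowCol_lt {u : X ⊗[ℂ] Y} {s : ℝ} (h : haagerupNorm j k u < s) :
    ∃ (r : ℕ) (x : Matrix (Fin 1) (Fin r) X) (y : Matrix (Fin r) (Fin 1) Y),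
      u = rowCol x y ∧ matNorm j x * matNorm k y < s := by
  obtain ⟨t, ⟨r, x, y, hu, rfl⟩, hts⟩ := exists_lt_of_csInf_lt
    (by obtain ⟨r, x, y, hu⟩ := exists_rowCol u; exact ⟨_, r, x, y, hu, rfl⟩) h
  exact ⟨r, x, y, hu, hts⟩

theorem rowCol_smul {n : Type*} [Fintype n] (c d : ℂ) (x : Matrix (Fin 1) n X)
    (y : Matrix n (Fin 1) Y) : rowCol (c • x) (d • y) = (c * d) • rowCol x y := by
  simp [rowCol, Finset.smul_sum, TensorProduct.smul_tmul', TensorProduct.tmul_smul, smul_smul,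
    mul_comm]

theorem exists_rowCol_balanced {u : X ⊗[ℂ] Y} {s : ℝ} (h : haagerupNorm j k u < s) :
    ∃ (r : ℕ) (x : Matrix (Fin 1) (Fin r) X) (y : Matrix (Fin r) (Fin 1) Y),
      u = rowCol x y ∧ matNorm j x ^ 2 ≤ s ∧ matNorm k y ^ 2 ≤ s := by
  obtain ⟨r, x, y, hu, hxy⟩ := exists_rowCol_lt j k h
  obtain ⟨t, ht, h1, h2⟩ := exists_balance (matNorm_nonneg j x) (matNorm_nonneg k y) hxy
  refine ⟨r, (t : ℂ) • x, ((t⁻¹ : ℝ) : ℂ) • y, ?_, ?_, ?_⟩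
  · rw [rowCol_smul, ← Complex.ofReal_mul, mul_inv_cancel₀ ht.ne', Complex.ofReal_one, one_smul, hu]
  · refine (pow_le_pow_left₀ (matNorm_nonneg j _) (matNorm_smul_le j _ _) 2).trans ?_
    rwa [Complex.norm_real, Real.norm_of_nonneg ht.le]
  · refine (pow_le_pow_left₀ (matNorm_nonneg k _) (matNorm_smul_le k _ _) 2).trans ?_
    rwa [Complex.norm_real, Real.norm_of_nonneg (inv_nonneg.2 ht.le)]

theorem haagerupNorm_add_le (u v : X ⊗[ℂ] Y) :
    haagerupNorm j k (u + v) ≤ haagerupNorm j k u + haagerupNorm j k v := by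
  refine le_of_forall_pos_le_add fun ε hε => ?_
  obtain ⟨r, x, y, hu, hx, hy⟩ :=
    exists_rowCol_balanced j k (lt_add_of_pos_right (haagerupNorm j k u) (half_pos hε))
  obtain ⟨r', x', y', hv, hx', hy'⟩ :=
    exists_rowCol_balanced j k (lt_add_of_pos_right (haagerupNorm j k v) (half_pos hε))
  rw [hu, hv, rowCol_add, ← hu, ← hv]
  refine (haagerupNorm_rowCol_le j k _ _).trans ?_
  have h1 := matNorm_fromCols_sq_le j x x'
  have h2 := matNorm_fromRows_sq_le k y y'
  nlinarith [sq_nonneg (matNorm j (Matrix.fromCols x x') - matNorm k (Matrix.fromRows y y'))]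

theorem haagerupNorm_zero : haagerupNorm j k (0 : X ⊗[ℂ] Y) = 0 := by
  refine le_antisymm ?_ (haagerupNorm_nonneg j k 0)
  have h := haagerupNorm_rowCol_le j k (0 : Matrix (Fin 1) (Fin 0) X) (0 : Matrix (Fin 0) (Fin 1) Y)
  have h0 : matNorm j (0 : Matrix (Fin 1) (Fin 0) X) ≤ 0 := matNorm_le j _ le_rfl fun ξ => by simp
  rw [le_antisymm h0 (matNorm_nonneg j _), zero_mul] at h
  simpa [rowCol] using h

theorem haagerupNorm_smul_le (c : ℂ) (u : X ⊗[ℂ] Y) :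
    haagerupNorm j k (c • u) ≤ ‖c‖ * haagerupNorm j k u := by
  refine le_of_forall_gt_imp_ge_of_dense fun s hs => ?_
  by_cases hc : c = 0
  · subst hc
    rw [zero_smul, haagerupNorm_zero]
    simpa using hs.le
  have hc' : 0 < ‖c‖ := norm_pos_iff.2 hc
  obtain ⟨r, x, y, hu, hxy⟩ := exists_rowCol_lt j k (u := u) (s := s / ‖c‖)
    (by rwa [lt_div_iff₀ hc', mul_comm])
  have h : c • u = rowCol (c • x) y := by
    simpa [hu] using (rowCol_smul c 1 x y).symm
  rw [h]
  refine (haagerupNorm_rowCol_le j k _ _).trans ?_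
  rw [lt_div_iff₀ hc'] at hxy
  have h1 := mul_le_mul_of_nonneg_right (matNorm_smul_le j c x) (matNorm_nonneg k y)
  nlinarith

/-! ### The operator space projective norm is a seminorm -/

theorem projNorm_nonneg (u : X ⊗[ℂ] Y) : 0 ≤ projNorm j k u := by
  refine Real.sInf_nonneg ?_
  rintro t ⟨p, q, α, x, y, β, -, rfl⟩
  have := matNorm_nonneg j x
  have := matNorm_nonneg k y
  positivity

theorem projNorm_contract_le {p q : Type*} [Fintype p] [Fintype q] (α : EuclideanSpace ℂ (p × q))
    (x : Matrix p p X) (y : Matrix q q Y) (β : EuclideanSpace ℂ (p × q)) :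
    projNorm j k (contract α x y β) ≤ ‖α‖ * matNorm j x * matNorm k y * ‖β‖ := by
  let e := (Fintype.equivFin p).symm
  let f := (Fintype.equivFin q).symm
  let ef := Equiv.prodCongr e f
  let R : EuclideanSpace ℂ (p × q) → EuclideanSpace ℂ (Fin (Fintype.card p) × Fin (Fintype.card q)) :=
    fun γ => WithLp.toLp 2 fun i => γ (ef i)
  have hR : ∀ γ, ‖R γ‖ = ‖γ‖ := fun γ => by
    rw [EuclideanSpace.norm_eq, EuclideanSpace.norm_eq]
    congr 1
    exact Equiv.sum_comp ef fun i => ‖γ i‖ ^ 2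
  have key : projNorm j k (contract α x y β) ≤
      ‖R α‖ * matNorm j (x.submatrix e e) * matNorm k (y.submatrix f f) * ‖R β‖ := by
    refine csInf_le ⟨0, ?_⟩ ⟨Fintype.card p, Fintype.card q, R α, x.submatrix e e,
      y.submatrix f f, R β, ?_, rfl⟩
    · rintro t ⟨p, q, α, x, y, β, -, rfl⟩
      have := matNorm_nonneg j x
      have := matNorm_nonneg k y
      positivity
    · unfold contract
      rw [← Equiv.sum_comp ef]
      refine Finset.sum_congr rfl fun r _ => ?_
      rw [← Equiv.sum_comp ef]
      rfl
  · refine key.trans ?_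
    rw [hR, hR]
    have h1 := matNorm_submatrix_le j x e.injective e.injective
    have h2 := matNorm_submatrix_le k y f.injective f.injective
    have := matNorm_nonneg j (x.submatrix e e)
    have := matNorm_nonneg k (y.submatrix f f)
    have := matNorm_nonneg j x
    gcongr

theorem contract_smul {p q : Type*} [Fintype p] [Fintype q] (a b c d : ℂ)
    (α : EuclideanSpace ℂ (p × q)) (x : Matrix p p X) (y : Matrix q q Y)
    (β : EuclideanSpace ℂ (p × q)) :
    contract (a • α) (b • x) (c • y) (d • β) = (a * b * c * d) • contract α x y β := by
  simp only [contract, Finset.smul_sum, PiLp.smul_apply, Matrix.smul_apply,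
    TensorProduct.smul_tmul', TensorProduct.tmul_smul, smul_smul, smul_eq_mul]
  refine Finset.sum_congr rfl fun r _ => Finset.sum_congr rfl fun s _ => ?_
  congr 1
  ring_nf

/-- The vector on `(p ⊕ p') × (q ⊕ q')` with the blocks `α` and `α'` on the diagonal. -/
def diagVec {p q p' q' : Type*} (α : EuclideanSpace ℂ (p × q)) (α' : EuclideanSpace ℂ (p' × q')) :
    EuclideanSpace ℂ ((p ⊕ p') × (q ⊕ q')) :=
  WithLp.toLp 2 fun
    | (Sum.inl i, Sum.inl l) => α (i, l)
    | (Sum.inr i, Sum.inr l) => α' (i, l)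
    | _ => 0

theorem norm_diagVec_sq {p q p' q' : Type*} [Fintype p] [Fintype q] [Fintype p'] [Fintype q']
    (α : EuclideanSpace ℂ (p × q)) (α' : EuclideanSpace ℂ (p' × q')) :
    ‖diagVec α α'‖ ^ 2 = ‖α‖ ^ 2 + ‖α'‖ ^ 2 := by
  simp only [EuclideanSpace.norm_sq_eq]
  simp [Fintype.sum_prod_type, Fintype.sum_sum_type, diagVec]

theorem contract_add {p q p' q' : Type*} [Fintype p] [Fintype q] [Fintype p'] [Fintype q']
    (α : EuclideanSpace ℂ (p × q)) (x : Matrix p p X) (y : Matrix q q Y)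
    (β : EuclideanSpace ℂ (p × q)) (α' : EuclideanSpace ℂ (p' × q')) (x' : Matrix p' p' X)
    (y' : Matrix q' q' Y) (β' : EuclideanSpace ℂ (p' × q')) :
    contract α x y β + contract α' x' y' β' =
      contract (diagVec α α') (Matrix.fromBlocks x 0 0 x') (Matrix.fromBlocks y 0 0 y')
        (diagVec β β') := by
  simp [contract, Fintype.sum_prod_type, Fintype.sum_sum_type, diagVec]

theorem exists_contract (u : X ⊗[ℂ] Y) :
    ∃ (p q : ℕ) (α : EuclideanSpace ℂ (Fin p × Fin q))
      (x : Matrix (Fin p) (Fin p) X) (y : Matrix (Fin q) (Fin q) Y)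
      (β : EuclideanSpace ℂ (Fin p × Fin q)), u = contract α x y β := by
  obtain ⟨r, x, y, rfl⟩ := exists_rowCol u
  refine ⟨r, r, WithLp.toLp 2 fun i => if i.1 = i.2 then 1 else 0,
    Matrix.diagonal fun i => x 0 i, Matrix.diagonal fun i => y i 0,
    WithLp.toLp 2 fun i => if i.1 = i.2 then 1 else 0, ?_⟩
  simp [contract, rowCol, Fintype.sum_prod_type, Matrix.diagonal_apply,
    TensorProduct.ite_tmul]

theorem exists_contract_lt {u : X ⊗[ℂ] Y} {s : ℝ} (h : projNorm j k u < s) :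
    ∃ (p q : ℕ) (α : EuclideanSpace ℂ (Fin p × Fin q))
      (x : Matrix (Fin p) (Fin p) X) (y : Matrix (Fin q) (Fin q) Y)
      (β : EuclideanSpace ℂ (Fin p × Fin q)),
      u = contract α x y β ∧ ‖α‖ * matNorm j x * matNorm k y * ‖β‖ < s := by
  obtain ⟨t, ⟨p, q, α, x, y, β, hu, rfl⟩, hts⟩ := exists_lt_of_csInf_lt
    (by obtain ⟨p, q, α, x, y, β, hu⟩ := exists_contract u
        exact ⟨_, p, q, α, x, y, β, hu, rfl⟩) h
  exact ⟨p, q, α, x, y, β, hu, hts⟩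

theorem exists_contract_balanced {u : X ⊗[ℂ] Y} {s : ℝ} (h : projNorm j k u < s) :
    ∃ (p q : ℕ) (α : EuclideanSpace ℂ (Fin p × Fin q))
      (x : Matrix (Fin p) (Fin p) X) (y : Matrix (Fin q) (Fin q) Y)
      (β : EuclideanSpace ℂ (Fin p × Fin q)),
      u = contract α x y β ∧ matNorm j x ≤ 1 ∧ matNorm k y ≤ 1 ∧ ‖α‖ ^ 2 ≤ s ∧ ‖β‖ ^ 2 ≤ s := by
  obtain ⟨p, q, α, x, y, β, hu, hs⟩ := exists_contract_lt j k h
  have hx := matNorm_nonneg j x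
  have hy := matNorm_nonneg k y
  obtain ⟨δ, hδs, hδ⟩ : ∃ δ : ℝ, ‖α‖ * (matNorm j x + δ) * (matNorm k y + δ) * ‖β‖ < s ∧ 0 < δ := by
    have hc : Filter.Tendsto (fun δ : ℝ => ‖α‖ * (matNorm j x + δ) * (matNorm k y + δ) * ‖β‖)
        (nhdsWithin 0 (Set.Ioi 0)) (nhds (‖α‖ * matNorm j x * matNorm k y * ‖β‖)) := by
      have : Continuous fun δ : ℝ => ‖α‖ * (matNorm j x + δ) * (matNorm k y + δ) * ‖β‖ := by
        fun_prop
      simpa using (this.tendsto 0).mono_left nhdsWithin_le_nhds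
    exact ((hc.eventually_lt_const hs).and self_mem_nhdsWithin).exists
  set c := matNorm j x + δ with hc
  set d := matNorm k y + δ with hd
  have hc0 : 0 < c := by linarith
  have hd0 : 0 < d := by linarith
  obtain ⟨t, ht, h1, h2⟩ := exists_balance (a := ‖α‖) (b := c * d * ‖β‖) (s := s)
    (norm_nonneg _) (by positivity) (by nlinarith)
  refine ⟨p, q, (t : ℂ) • α, ((c⁻¹ : ℝ) : ℂ) • x, ((d⁻¹ : ℝ) : ℂ) • y,
    ((t⁻¹ * (c * d) : ℝ) : ℂ) • β, ?_, ?_, ?_, ?_, ?_⟩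
  · rw [contract_smul, ← Complex.ofReal_mul, ← Complex.ofReal_mul, ← Complex.ofReal_mul, ← hu]
    have : t * c⁻¹ * d⁻¹ * (t⁻¹ * (c * d)) = 1 := by field_simp
    rw [this, Complex.ofReal_one, one_smul]
  · refine (matNorm_smul_le j _ _).trans ?_
    rw [Complex.norm_real, Real.norm_of_nonneg (inv_nonneg.2 hc0.le), inv_mul_le_iff₀ hc0]
    linarith
  · refine (matNorm_smul_le k _ _).trans ?_
    rw [Complex.norm_real, Real.norm_of_nonneg (inv_nonneg.2 hd0.le), inv_mul_le_iff₀ hd0]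
    linarith
  · rwa [norm_smul, Complex.norm_real, Real.norm_of_nonneg ht.le]
  · rw [norm_smul, Complex.norm_real, Real.norm_of_nonneg (by positivity), mul_assoc]
    exact h2

theorem projNorm_add_le (u v : X ⊗[ℂ] Y) :
    projNorm j k (u + v) ≤ projNorm j k u + projNorm j k v := by
  refine le_of_forall_pos_le_add fun ε hε => ?_
  obtain ⟨p, q, α, x, y, β, hu, hx, hy, hα, hβ⟩ :=
    exists_contract_balanced j k (lt_add_of_pos_right (projNorm j k u) (half_pos hε))
  obtain ⟨p', q', α', x', y', β', hv, hx', hy', hα', hβ'⟩ :=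
    exists_contract_balanced j k (lt_add_of_pos_right (projNorm j k v) (half_pos hε))
  rw [hu, hv, contract_add, ← hu, ← hv]
  refine (projNorm_contract_le j k _ _ _ _).trans ?_
  have h1 := norm_diagVec_sq α α'
  have h2 := norm_diagVec_sq β β'
  have h3 := matNorm_fromBlocks_diag_le j x x' hx hx'
  have h4 := matNorm_fromBlocks_diag_le k y y' hy hy'
  have h5 := matNorm_nonneg j (Matrix.fromBlocks x 0 0 x')
  have h6 := matNorm_nonneg k (Matrix.fromBlocks y 0 0 y')
  calc ‖diagVec α α'‖ * matNorm j (Matrix.fromBlocks x 0 0 x') *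
        matNorm k (Matrix.fromBlocks y 0 0 y') * ‖diagVec β β'‖
      ≤ ‖diagVec α α'‖ * 1 * 1 * ‖diagVec β β'‖ := by gcongr
    _ ≤ _ := by nlinarith [sq_nonneg (‖diagVec α α'‖ - ‖diagVec β β'‖)]

theorem projNorm_zero : projNorm j k (0 : X ⊗[ℂ] Y) = 0 := by
  refine le_antisymm ?_ (projNorm_nonneg j k 0)
  simpa [contract] using projNorm_contract_le j k (0 : EuclideanSpace ℂ (Fin 0 × Fin 0)) 0 0 0

theorem projNorm_smul_le (c : ℂ) (u : X ⊗[ℂ] Y) :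
    projNorm j k (c • u) ≤ ‖c‖ * projNorm j k u := by
  refine le_of_forall_gt_imp_ge_of_dense fun s hs => ?_
  by_cases hc : c = 0
  · subst hc
    rw [zero_smul, projNorm_zero]
    simpa using hs.le
  have hc' : 0 < ‖c‖ := norm_pos_iff.2 hc
  obtain ⟨p, q, α, x, y, β, hu, hxy⟩ := exists_contract_lt j k (u := u) (s := s / ‖c‖)
    (by rwa [lt_div_iff₀ hc', mul_comm])
  have h : c • u = contract (c • α) x y β := by
    simpa [hu] using (contract_smul c 1 1 1 α x y β).symm
  rw [h]
  refine (projNorm_contract_le j k _ _ _ _).trans ?_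
  rw [lt_div_iff₀ hc'] at hxy
  rw [norm_smul]
  linarith

end TensorNorms

section TensorProducts

variable {H K : Type*} [NormedAddCommGroup H] [InnerProductSpace ℂ H]
  [NormedAddCommGroup K] [InnerProductSpace ℂ K]

section Spaces

variable {X Y : Type*} [NormedAddCommGroup X] [NormedSpace ℂ X]
  [NormedAddCommGroup Y] [NormedSpace ℂ Y]
variable (j : X →ₗᵢ[ℂ] (H →L[ℂ] H)) (k : Y →ₗᵢ[ℂ] (K →L[ℂ] K))

/-- The algebraic tensor product `X ⊗ Y`, normed by the operator space projective norm. -/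
def AlgProj (_ : X →ₗᵢ[ℂ] (H →L[ℂ] H)) (_ : Y →ₗᵢ[ℂ] (K →L[ℂ] K)) : Type _ := X ⊗[ℂ] Y

/-- The algebraic tensor product `X ⊗ Y`, normed by the Haagerup norm. -/
def AlgHaagerup (_ : X →ₗᵢ[ℂ] (H →L[ℂ] H)) (_ : Y →ₗᵢ[ℂ] (K →L[ℂ] K)) : Type _ := X ⊗[ℂ] Y

instance : AddCommGroup (AlgProj j k) := inferInstanceAs (AddCommGroup (X ⊗[ℂ] Y))
instance : Module ℂ (AlgProj j k) := inferInstanceAs (Module ℂ (X ⊗[ℂ] Y))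
instance : AddCommGroup (AlgHaagerup j k) := inferInstanceAs (AddCommGroup (X ⊗[ℂ] Y))
instance : Module ℂ (AlgHaagerup j k) := inferInstanceAs (Module ℂ (X ⊗[ℂ] Y))

/-- The operator space projective norm as a seminorm. -/
def projSeminorm : Seminorm ℂ (AlgProj j k) :=
  Seminorm.ofSMulLE (projNorm j k) (projNorm_zero j k) (projNorm_add_le j k) (projNorm_smul_le j k)

/-- The Haagerup norm as a seminorm. -/
def haagerupSeminorm : Seminorm ℂ (AlgHaagerup j k) :=
  Seminorm.ofSMulLE (haagerupNorm j k) (haagerupNorm_zero j k) (haagerupNorm_add_le j k)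
    (haagerupNorm_smul_le j k)

instance : SeminormedAddCommGroup (AlgProj j k) :=
  (projSeminorm j k).toAddGroupSeminorm.toSeminormedAddCommGroup

instance : SeminormedAddCommGroup (AlgHaagerup j k) :=
  (haagerupSeminorm j k).toAddGroupSeminorm.toSeminormedAddCommGroup

theorem AlgProj.norm_def (u : AlgProj j k) : ‖u‖ = projNorm j k u := rfl

theorem AlgHaagerup.norm_def (u : AlgHaagerup j k) : ‖u‖ = haagerupNorm j k u := rfl

instance : NormedSpace ℂ (AlgProj j k) where
  norm_smul_le := projNorm_smul_le j k

instance : NormedSpace ℂ (AlgHaagerup j k) where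
  norm_smul_le := haagerupNorm_smul_le j k

end Spaces

section Algebras

variable {A B : Type*} [NonUnitalNormedRing A] [NormedSpace ℂ A] [IsScalarTower ℂ A A]
  [SMulCommClass ℂ A A] [NonUnitalNormedRing B] [NormedSpace ℂ B] [IsScalarTower ℂ B B]
  [SMulCommClass ℂ B B]
variable (j : A →ₗᵢ[ℂ] (H →L[ℂ] H)) (k : B →ₗᵢ[ℂ] (K →L[ℂ] K))
  [IsCompletelyContractiveAlgebra j] [IsCompletelyContractiveAlgebra k]

theorem rowCol_mul {m n : Type*} [Fintype m] [Fintype n] (x : Matrix (Fin 1) m A)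
    (y : Matrix m (Fin 1) B) (x' : Matrix (Fin 1) n A) (y' : Matrix n (Fin 1) B) :
    rowCol x y * rowCol x' y' =
      rowCol ((Matrix.kroneckerMap (· * ·) x x').submatrix (fun _ => ((0 : Fin 1), (0 : Fin 1))) id)
        ((Matrix.kroneckerMap (· * ·) y y').submatrix id fun _ => ((0 : Fin 1), (0 : Fin 1))) := by
  simp [rowCol, Fintype.sum_prod_type, Finset.sum_mul_sum, Algebra.TensorProduct.tmul_mul_tmul]

theorem haagerupNorm_mul_le (u v : A ⊗[ℂ] B) :
    haagerupNorm j k (u * v) ≤ haagerupNorm j k u * haagerupNorm j k v := by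
  refine le_of_forall_gt_imp_ge_of_dense fun s hs => ?_
  obtain ⟨δ, hδs, hδ⟩ : ∃ δ : ℝ, (haagerupNorm j k u + δ) * (haagerupNorm j k v + δ) < s ∧ 0 < δ := by
    have hc : Filter.Tendsto (fun δ : ℝ => (haagerupNorm j k u + δ) * (haagerupNorm j k v + δ))
        (nhdsWithin 0 (Set.Ioi 0)) (nhds (haagerupNorm j k u * haagerupNorm j k v)) := by
      have : Continuous fun δ : ℝ => (haagerupNorm j k u + δ) * (haagerupNorm j k v + δ) := by
        fun_prop
      simpa using (this.tendsto 0).mono_left nhdsWithin_le_nhds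
    exact ((hc.eventually_lt_const hs).and self_mem_nhdsWithin).exists
  obtain ⟨r, x, y, hu, hxy⟩ := exists_rowCol_lt j k (lt_add_of_pos_right (haagerupNorm j k u) hδ)
  obtain ⟨r', x', y', hv, hxy'⟩ :=
    exists_rowCol_lt j k (lt_add_of_pos_right (haagerupNorm j k v) hδ)
  refine le_trans ?_ hδs.le
  refine le_trans ?_ (mul_le_mul hxy.le hxy'.le
    (mul_nonneg (matNorm_nonneg j x') (matNorm_nonneg k y'))
    (add_nonneg (haagerupNorm_nonneg j k u) hδ.le))
  rw [hu, hv, rowCol_mul]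
  refine (haagerupNorm_rowCol_le j k _ _).trans ?_
  have hi : Function.Injective fun _ : Fin 1 => ((0 : Fin 1), (0 : Fin 1)) :=
    Function.injective_of_subsingleton _
  have h1 := (matNorm_submatrix_le j (Matrix.kroneckerMap (· * ·) x x') hi
    Function.injective_id).trans (matNorm_kronecker_le' j x x')
  have h2 := (matNorm_submatrix_le k (Matrix.kroneckerMap (· * ·) y y') Function.injective_id
    hi).trans (matNorm_kronecker_le' k y y')
  refine (mul_le_mul h1 h2 (matNorm_nonneg k _)
    (mul_nonneg (matNorm_nonneg j x) (matNorm_nonneg j x'))).trans_eq ?_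
  ring

/-- The tensor product of two vectors indexed by pairs. -/
def pairVec {p q p' q' : Type*} (α : EuclideanSpace ℂ (p × q)) (α' : EuclideanSpace ℂ (p' × q')) :
    EuclideanSpace ℂ ((p × p') × (q × q')) :=
  WithLp.toLp 2 fun i => α (i.1.1, i.2.1) * α' (i.1.2, i.2.2)

theorem norm_pairVec {p q p' q' : Type*} [Fintype p] [Fintype q] [Fintype p'] [Fintype q']
    (α : EuclideanSpace ℂ (p × q)) (α' : EuclideanSpace ℂ (p' × q')) :
    ‖pairVec α α'‖ = ‖α‖ * ‖α'‖ := by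
  refine (sq_eq_sq₀ (norm_nonneg _) (by positivity)).1 ?_
  rw [mul_pow]
  simp only [EuclideanSpace.norm_sq_eq]
  rw [Finset.sum_mul_sum, ← Fintype.sum_prod_type', ← Equiv.sum_comp (Equiv.prodProdProdComm p q p' q')]
  simp [pairVec, mul_pow]

theorem contract_mul {p q p' q' : Type*} [Fintype p] [Fintype q] [Fintype p'] [Fintype q']
    (α : EuclideanSpace ℂ (p × q)) (x : Matrix p p A) (y : Matrix q q B)
    (β : EuclideanSpace ℂ (p × q)) (α' : EuclideanSpace ℂ (p' × q')) (x' : Matrix p' p' A)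
    (y' : Matrix q' q' B) (β' : EuclideanSpace ℂ (p' × q')) :
    contract α x y β * contract α' x' y' β' =
      contract (pairVec α α') (Matrix.kroneckerMap (· * ·) x x')
        (Matrix.kroneckerMap (· * ·) y y') (pairVec β β') := by
  unfold contract
  rw [Finset.sum_mul_sum, ← Fintype.sum_prod_type',
    ← Equiv.sum_comp (Equiv.prodProdProdComm p q p' q')]
  refine Finset.sum_congr rfl fun r _ => ?_
  rw [Finset.sum_mul_sum, ← Fintype.sum_prod_type',
    ← Equiv.sum_comp (Equiv.prodProdProdComm p q p' q')]
  refine Finset.sum_congr rfl fun c _ => ?_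
  simp only [smul_mul_smul_comm, Algebra.TensorProduct.tmul_mul_tmul]
  congr 1
  simp [pairVec]
  ring

theorem projNorm_mul_le (u v : A ⊗[ℂ] B) :
    projNorm j k (u * v) ≤ projNorm j k u * projNorm j k v := by
  refine le_of_forall_gt_imp_ge_of_dense fun s hs => ?_
  obtain ⟨δ, hδs, hδ⟩ : ∃ δ : ℝ, (projNorm j k u + δ) * (projNorm j k v + δ) < s ∧ 0 < δ := by
    have hc : Filter.Tendsto (fun δ : ℝ => (projNorm j k u + δ) * (projNorm j k v + δ))
        (nhdsWithin 0 (Set.Ioi 0)) (nhds (projNorm j k u * projNorm j k v)) := by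
      have : Continuous fun δ : ℝ => (projNorm j k u + δ) * (projNorm j k v + δ) := by
        fun_prop
      simpa using (this.tendsto 0).mono_left nhdsWithin_le_nhds
    exact ((hc.eventually_lt_const hs).and self_mem_nhdsWithin).exists
  obtain ⟨p, q, α, x, y, β, hu, hxy⟩ :=
    exists_contract_lt j k (lt_add_of_pos_right (projNorm j k u) hδ)
  obtain ⟨p', q', α', x', y', β', hv, hxy'⟩ :=
    exists_contract_lt j k (lt_add_of_pos_right (projNorm j k v) hδ)
  have hx := matNorm_nonneg j x
  have hy := matNorm_nonneg k y
  have hx' := matNorm_nonneg j x'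
  have hy' := matNorm_nonneg k y'
  refine le_trans ?_ hδs.le
  refine le_trans ?_ (mul_le_mul hxy.le hxy'.le (by positivity)
    (add_nonneg (projNorm_nonneg j k u) hδ.le))
  rw [hu, hv, contract_mul]
  refine (projNorm_contract_le j k _ _ _ _).trans ?_
  rw [norm_pairVec, norm_pairVec]
  have h1 := matNorm_kronecker_le' j x x'
  have h2 := matNorm_kronecker_le' k y y'
  have h3 := matNorm_nonneg k (Matrix.kroneckerMap (· * ·) y y')
  calc _ ≤ ‖α‖ * ‖α'‖ * (matNorm j x * matNorm j x') * (matNorm k y * matNorm k y') *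
        (‖β‖ * ‖β'‖) := by gcongr
    _ = _ := by ring

/-- The algebraic tensor product is an algebra for `(a ⊗ b) (c ⊗ d) = ac ⊗ bd`. -/
instance : NonUnitalRing (AlgProj j k) := inferInstanceAs (NonUnitalRing (A ⊗[ℂ] B))

instance : NonUnitalRing (AlgHaagerup j k) := inferInstanceAs (NonUnitalRing (A ⊗[ℂ] B))

instance : NonUnitalSeminormedRing (AlgProj j k) where
  __ := (inferInstance : SeminormedAddCommGroup (AlgProj j k))
  __ := (inferInstance : NonUnitalRing (AlgProj j k))
  norm_mul_le := projNorm_mul_le j k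

instance : NonUnitalSeminormedRing (AlgHaagerup j k) where
  __ := (inferInstance : SeminormedAddCommGroup (AlgHaagerup j k))
  __ := (inferInstance : NonUnitalRing (AlgHaagerup j k))
  norm_mul_le := haagerupNorm_mul_le j k

instance : IsScalarTower ℂ (AlgProj j k) (AlgProj j k) :=
  inferInstanceAs (IsScalarTower ℂ (A ⊗[ℂ] B) (A ⊗[ℂ] B))

instance : SMulCommClass ℂ (AlgProj j k) (AlgProj j k) :=
  inferInstanceAs (SMulCommClass ℂ (A ⊗[ℂ] B) (A ⊗[ℂ] B))

instance : IsScalarTower ℂ (AlgHaagerup j k) (AlgHaagerup j k) :=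
  inferInstanceAs (IsScalarTower ℂ (A ⊗[ℂ] B) (A ⊗[ℂ] B))

instance : SMulCommClass ℂ (AlgHaagerup j k) (AlgHaagerup j k) :=
  inferInstanceAs (SMulCommClass ℂ (A ⊗[ℂ] B) (A ⊗[ℂ] B))

end Algebras

end TensorProducts

section Completion

open UniformSpace UniformSpace.Completion

/-- The completion of a seminormed algebra without unit. -/
def AlgCompletion (R : Type*) [UniformSpace R] : Type _ := Completion R

variable (R : Type*) [NonUnitalSeminormedRing R]

instance : NormedAddCommGroup (AlgCompletion R) :=
  inferInstanceAs (NormedAddCommGroup (Completion R))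

instance : CompleteSpace (AlgCompletion R) := inferInstanceAs (CompleteSpace (Completion R))

instance [NormedSpace ℂ R] : NormedSpace ℂ (AlgCompletion R) :=
  inferInstanceAs (NormedSpace ℂ (Completion R))

/-- The canonical map of a seminormed algebra to its completion. -/
def toAlgCompletion {R : Type*} [UniformSpace R] (a : R) : AlgCompletion R := (a : Completion R)

/-- The continuous extension of the multiplication. -/
instance : Mul (AlgCompletion R) :=
  ⟨Function.curry <| (isDenseInducing_coe.prodMap isDenseInducing_coe).extend
    (toAlgCompletion ∘ Function.uncurry ((· * ·) : R → R → R))⟩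

variable {R}

theorem toAlgCompletion_mul (a b : R) :
    toAlgCompletion (a * b) = toAlgCompletion a * toAlgCompletion b :=
  ((isDenseInducing_coe.prodMap isDenseInducing_coe).extend_eq
    ((continuous_coe R).comp continuous_mul) (a, b)).symm

theorem continuous_algCompletion_mul :
    Continuous fun x : AlgCompletion R × AlgCompletion R => x.1 * x.2 := by
  let m := (AddMonoidHom.mul : R →+ R →+ R).compr₂ toCompl
  have : Continuous fun p : R × R => m p.1 p.2 := (continuous_coe R).comp continuous_mul
  have di : IsDenseInducing (toCompl : R → Completion R) := isDenseInducing_coe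
  exact di.extend_Z_bilin di this

theorem AlgCompletion.continuous_mul' {T : Type*} [TopologicalSpace T] {f g : T → AlgCompletion R}
    (hf : Continuous f) (hg : Continuous g) : Continuous fun t => f t * g t :=
  continuous_algCompletion_mul.comp (hf.prodMk hg)

theorem AlgCompletion.induction {P : AlgCompletion R → Prop} (hc : IsClosed {x | P x})
    (h : ∀ a : R, P (toAlgCompletion a)) (x : AlgCompletion R) : P x :=
  Completion.induction_on x hc h

theorem toAlgCompletion_add (a b : R) :
    toAlgCompletion (a + b) = toAlgCompletion a + toAlgCompletion b := coe_add a b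

theorem toAlgCompletion_zero : toAlgCompletion (0 : R) = 0 := coe_zero

theorem norm_toAlgCompletion (a : R) : ‖toAlgCompletion a‖ = ‖a‖ := norm_coe a

theorem toAlgCompletion_smul [NormedSpace ℂ R] (c : ℂ) (a : R) :
    toAlgCompletion (c • a) = c • toAlgCompletion a := coe_smul c a

theorem AlgCompletion.zero_mul' (x : AlgCompletion R) : 0 * x = 0 := by
  refine AlgCompletion.induction (isClosed_eq (AlgCompletion.continuous_mul' continuous_const continuous_id) continuous_const) (fun a => ?_) x
  change 0 * toAlgCompletion a = 0
  rw [← toAlgCompletion_zero, ← toAlgCompletion_mul, zero_mul]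

theorem AlgCompletion.mul_zero' (x : AlgCompletion R) : x * 0 = 0 := by
  refine AlgCompletion.induction (isClosed_eq (AlgCompletion.continuous_mul' continuous_id continuous_const) continuous_const) (fun a => ?_) x
  change toAlgCompletion a * 0 = 0
  rw [← toAlgCompletion_zero, ← toAlgCompletion_mul, mul_zero]

theorem AlgCompletion.mul_add' (x y z : AlgCompletion R) : x * (y + z) = x * y + x * z := by
  refine AlgCompletion.induction (isClosed_eq (AlgCompletion.continuous_mul' continuous_id continuous_const)
    ((AlgCompletion.continuous_mul' continuous_id continuous_const).add (AlgCompletion.continuous_mul' continuous_id continuous_const))) (fun a => ?_) x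
  refine AlgCompletion.induction (isClosed_eq (AlgCompletion.continuous_mul' continuous_const (continuous_id.add continuous_const))
    ((AlgCompletion.continuous_mul' continuous_const continuous_id).add continuous_const)) (fun b => ?_) y
  refine AlgCompletion.induction (isClosed_eq (AlgCompletion.continuous_mul' continuous_const (continuous_const.add continuous_id))
    (continuous_const.add (AlgCompletion.continuous_mul' continuous_const continuous_id))) (fun c => ?_) z
  change toAlgCompletion a * (toAlgCompletion b + toAlgCompletion c) =
    toAlgCompletion a * toAlgCompletion b + toAlgCompletion a * toAlgCompletion c
  simp only [← toAlgCompletion_add, ← toAlgCompletion_mul, mul_add]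

theorem AlgCompletion.add_mul' (x y z : AlgCompletion R) : (x + y) * z = x * z + y * z := by
  refine AlgCompletion.induction (isClosed_eq (AlgCompletion.continuous_mul' (continuous_id.add continuous_const) continuous_const)
    ((AlgCompletion.continuous_mul' continuous_id continuous_const).add continuous_const)) (fun a => ?_) x
  refine AlgCompletion.induction (isClosed_eq (AlgCompletion.continuous_mul' (continuous_const.add continuous_id) continuous_const)
    (continuous_const.add (AlgCompletion.continuous_mul' continuous_id continuous_const))) (fun b => ?_) y
  refine AlgCompletion.induction (isClosed_eq (AlgCompletion.continuous_mul' continuous_const continuous_id)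
    ((AlgCompletion.continuous_mul' continuous_const continuous_id).add (AlgCompletion.continuous_mul' continuous_const continuous_id))) (fun c => ?_) z
  change (toAlgCompletion a + toAlgCompletion b) * toAlgCompletion c =
    toAlgCompletion a * toAlgCompletion c + toAlgCompletion b * toAlgCompletion c
  simp only [← toAlgCompletion_add, ← toAlgCompletion_mul, add_mul]

theorem AlgCompletion.mul_assoc' (x y z : AlgCompletion R) : x * y * z = x * (y * z) := by
  refine AlgCompletion.induction (isClosed_eq (AlgCompletion.continuous_mul' (AlgCompletion.continuous_mul' continuous_id continuous_const) continuous_const)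
    (AlgCompletion.continuous_mul' continuous_id continuous_const)) (fun a => ?_) x
  refine AlgCompletion.induction (isClosed_eq (AlgCompletion.continuous_mul' (AlgCompletion.continuous_mul' continuous_const continuous_id) continuous_const)
    (AlgCompletion.continuous_mul' continuous_const (AlgCompletion.continuous_mul' continuous_id continuous_const))) (fun b => ?_) y
  refine AlgCompletion.induction (isClosed_eq (AlgCompletion.continuous_mul' continuous_const continuous_id)
    (AlgCompletion.continuous_mul' continuous_const (AlgCompletion.continuous_mul' continuous_const continuous_id))) (fun c => ?_) z
  change toAlgCompletion a * toAlgCompletion b * toAlgCompletion c =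
    toAlgCompletion a * (toAlgCompletion b * toAlgCompletion c)
  simp only [← toAlgCompletion_mul, mul_assoc]

theorem AlgCompletion.norm_mul_le' (x y : AlgCompletion R) : ‖x * y‖ ≤ ‖x‖ * ‖y‖ := by
  refine AlgCompletion.induction (isClosed_le (AlgCompletion.continuous_mul' continuous_id continuous_const).norm
    (continuous_norm.mul continuous_const)) (fun a => ?_) x
  refine AlgCompletion.induction (isClosed_le (AlgCompletion.continuous_mul' continuous_const continuous_id).norm
    (continuous_const.mul continuous_norm)) (fun b => ?_) y
  change ‖toAlgCompletion a * toAlgCompletion b‖ ≤ ‖toAlgCompletion a‖ * ‖toAlgCompletion b‖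
  rw [← toAlgCompletion_mul, norm_toAlgCompletion, norm_toAlgCompletion, norm_toAlgCompletion]
  exact norm_mul_le a b

theorem AlgCompletion.smul_mul' [NormedSpace ℂ R] [IsScalarTower ℂ R R] (c : ℂ)
    (x y : AlgCompletion R) : (c • x) * y = c • (x * y) := by
  refine AlgCompletion.induction (isClosed_eq (AlgCompletion.continuous_mul' (continuous_id.const_smul c) continuous_const)
    ((AlgCompletion.continuous_mul' continuous_id continuous_const).const_smul c)) (fun a => ?_) x
  refine AlgCompletion.induction (isClosed_eq (AlgCompletion.continuous_mul' continuous_const continuous_id)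
    ((AlgCompletion.continuous_mul' continuous_const continuous_id).const_smul c)) (fun b => ?_) y
  change (c • toAlgCompletion a) * toAlgCompletion b = c • (toAlgCompletion a * toAlgCompletion b)
  rw [← toAlgCompletion_mul, ← toAlgCompletion_smul, ← toAlgCompletion_smul,
    ← toAlgCompletion_mul, smul_mul_assoc]

theorem AlgCompletion.mul_smul' [NormedSpace ℂ R] [SMulCommClass ℂ R R] (c : ℂ)
    (x y : AlgCompletion R) : c • (x * y) = x * (c • y) := by
  refine AlgCompletion.induction (isClosed_eq ((AlgCompletion.continuous_mul' continuous_id continuous_const).const_smul c)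
    (AlgCompletion.continuous_mul' continuous_id continuous_const)) (fun a => ?_) x
  refine AlgCompletion.induction (isClosed_eq ((AlgCompletion.continuous_mul' continuous_const continuous_id).const_smul c)
    (AlgCompletion.continuous_mul' continuous_const (continuous_id.const_smul c))) (fun b => ?_) y
  change c • (toAlgCompletion a * toAlgCompletion b) = toAlgCompletion a * (c • toAlgCompletion b)
  rw [← toAlgCompletion_mul, ← toAlgCompletion_smul, ← toAlgCompletion_smul,
    ← toAlgCompletion_mul, mul_smul_comm]

instance : NonUnitalNormedRing (AlgCompletion R) where
  __ := (inferInstance : NormedAddCommGroup (AlgCompletion R))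
  __ := (inferInstance : Mul (AlgCompletion R))
  zero_mul := AlgCompletion.zero_mul'
  mul_zero := AlgCompletion.mul_zero'
  left_distrib := AlgCompletion.mul_add'
  right_distrib := AlgCompletion.add_mul'
  mul_assoc := AlgCompletion.mul_assoc'
  norm_mul_le := AlgCompletion.norm_mul_le'

instance [NormedSpace ℂ R] [IsScalarTower ℂ R R] :
    IsScalarTower ℂ (AlgCompletion R) (AlgCompletion R) where
  smul_assoc := AlgCompletion.smul_mul'

instance [NormedSpace ℂ R] [SMulCommClass ℂ R R] :
    SMulCommClass ℂ (AlgCompletion R) (AlgCompletion R) where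
  smul_comm := AlgCompletion.mul_smul'

end Completion

section Banach

variable {H K A B : Type*} [NormedAddCommGroup H] [InnerProductSpace ℂ H]
  [NormedAddCommGroup K] [InnerProductSpace ℂ K]
  [NonUnitalNormedRing A] [NormedSpace ℂ A] [NonUnitalNormedRing B] [NormedSpace ℂ B]

/-- The operator space projective tensor product: the completion of the algebraic tensor product in
the operator space projective norm. -/
abbrev ProjTensor (j : A →ₗᵢ[ℂ] (H →L[ℂ] H)) (k : B →ₗᵢ[ℂ] (K →L[ℂ] K)) : Type _ :=
  AlgCompletion (AlgProj j k)

/-- The Haagerup tensor product: the completion of the algebraic tensor product in the Haagerup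
norm. -/
abbrev HaagerupTensor (j : A →ₗᵢ[ℂ] (H →L[ℂ] H)) (k : B →ₗᵢ[ℂ] (K →L[ℂ] K)) : Type _ :=
  AlgCompletion (AlgHaagerup j k)

end Banach

section Arens

variable {A : Type*} [NonUnitalNormedRing A] [NormedSpace ℂ A] [IsScalarTower ℂ A A]
  [SMulCommClass ℂ A A]

/-- The map `b ↦ f b` from `A` to its dual, where `(f b) a = f (b * a)`. -/
def dualMulRight : StrongDual ℂ A →L[ℂ] A →L[ℂ] StrongDual ℂ A :=
  (ContinuousLinearMap.compL ℂ A (A →L[ℂ] A) (StrongDual ℂ A)).flip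
    (ContinuousLinearMap.mul ℂ A) ∘L ContinuousLinearMap.compL ℂ A A ℂ

/-- The map `b ↦ b f` from `A` to its dual, where `(b f) a = f (a * b)`. -/
def dualMulLeft : StrongDual ℂ A →L[ℂ] A →L[ℂ] StrongDual ℂ A :=
  (ContinuousLinearMap.compL ℂ A (A →L[ℂ] A) (StrongDual ℂ A)).flip
    (ContinuousLinearMap.mul ℂ A).flip ∘L ContinuousLinearMap.compL ℂ A A ℂ

theorem dualMulRight_apply (f : StrongDual ℂ A) (b a : A) : dualMulRight f b a = f (b * a) := rfl

theorem dualMulLeft_apply (f : StrongDual ℂ A) (b a : A) : dualMulLeft f b a = f (a * b) := rfl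

/-- The first Arens product, `(F □ G) f = F (b ↦ G (f b))`. -/
def arensFst (F G : StrongDual ℂ (StrongDual ℂ A)) : StrongDual ℂ (StrongDual ℂ A) :=
  F ∘L ContinuousLinearMap.compL ℂ A (StrongDual ℂ A) ℂ G ∘L dualMulRight

/-- The second Arens product, `(F ◊ G) f = G (b ↦ F (b f))`. -/
def arensSnd (F G : StrongDual ℂ (StrongDual ℂ A)) : StrongDual ℂ (StrongDual ℂ A) :=
  G ∘L ContinuousLinearMap.compL ℂ A (StrongDual ℂ A) ℂ F ∘L dualMulLeft

theorem arensFst_apply (F G : StrongDual ℂ (StrongDual ℂ A)) (f : StrongDual ℂ A) :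
    arensFst F G f = F (G ∘L dualMulRight f) := rfl

theorem arensSnd_apply (F G : StrongDual ℂ (StrongDual ℂ A)) (f : StrongDual ℂ A) :
    arensSnd F G f = G (F ∘L dualMulLeft f) := rfl

variable (A) in
/-- A Banach algebra is Arens regular if the two Arens products on its bidual coincide. -/
def IsArensRegular : Prop :=
  ∀ F G : StrongDual ℂ (StrongDual ℂ A), arensFst F G = arensSnd F G

end Arens

end OperatorSpace

end

/-! Both Arens products of `F` and `G` at a functional `f` see only the bilinear form `(a, a') ↦ f
(a * a')`: `F` acts on the left factor and `G` on the right one, and the two products differ only in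
the order of the two evaluations. Hence regularity of `C` passes to `A` as soon as every such form
can be written as `φ (S a * T a')` with `φ` in the dual of `C` and fixed bounded linear maps `S, T :
A → C`. These maps need not be multiplicative (`IsArensRegular.of_factor`).

For a tensor product, choose `b * b' ≠ 0` and, by Hahn-Banach, `g` with `g (b * b') = 1`. Put `S a =
a ⊗ b`, `T a = a ⊗ b'` and `φ = f ⊗ g`. Then `φ (S a * T a') = f (a * a') * g (b * b') = f (a *
a')`. No unit or approximate identity enters, only a nonzero product in the other algebra.

The analytic input is that `f ⊗ g` is bounded by `‖f‖ * ‖g‖` for both norms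
(`norm_dualTensor_le_haagerupNorm`, `norm_dualTensor_le_projNorm`). This rests on the fact that a
bounded functional on an operator space is completely bounded with the same norm
(`sum_norm_sq_dual_le`): entrywise application of `f` to a matrix `x` gives a scalar matrix of
operator norm at most `‖f‖ * matNorm j x`. With this, the values of `f ⊗ g` become products of
scalar matrices and vectors, which Cauchy-Schwarz controls. -/

noncomputable section

namespace OperatorSpace

/-! ### Complete boundedness of functionals -/

section CompletelyBounded

variable {H X : Type*} [NormedAddCommGroup H] [InnerProductSpace ℂ H]
  [NormedAddCommGroup X] [NormedSpace ℂ X] (j : X →ₗᵢ[ℂ] (H →L[ℂ] H))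

/-- Compressing `x` by a scalar row and a scalar column multiplies its norm by at most their
Euclidean norms. Evaluated at `h`, the compression is the row `α` applied to the image of the vector
`(β l • h)` under `x`; that vector has norm `‖β‖₂ * ‖h‖`, and Cauchy-Schwarz handles the row. -/
theorem norm_sum_smul_le_matNorm {m n : Type*} [Fintype m] [Fintype n] (x : Matrix m n X)
    (α : m → ℂ) (β : n → ℂ) :
    ‖∑ i, ∑ l, (α i * β l) • x i l‖ ≤
      √(∑ i, ‖α i‖ ^ 2) * (matNorm j x * √(∑ l, ‖β l‖ ^ 2)) := by
  rw [← j.norm_map]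
  refine ContinuousLinearMap.opNorm_le_bound _
    (mul_nonneg (Real.sqrt_nonneg _) (mul_nonneg (matNorm_nonneg j x) (Real.sqrt_nonneg _)))
    fun h => ?_
  have h1 : j (∑ i, ∑ l, (α i * β l) • x i l) h =
      ∑ i, α i • ∑ l, j (x i l) (β l • h) := by
    simp [map_sum, Finset.smul_sum, smul_smul]
  rw [h1]
  have h2 : ‖∑ i, α i • ∑ l, j (x i l) (β l • h)‖ ≤
      ∑ i, ‖α i‖ * ‖∑ l, j (x i l) (β l • h)‖ :=
    (norm_sum_le _ _).trans_eq (by simp only [norm_smul])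
  refine h2.trans ((Real.sum_mul_le_sqrt_mul_sqrt _ _ _).trans ?_)
  rw [mul_assoc]
  refine mul_le_mul_of_nonneg_left ?_ (Real.sqrt_nonneg _)
  refine (Real.sqrt_le_sqrt (matNorm_bound j x fun l => β l • h)).trans_eq ?_
  simp only [norm_smul, mul_pow, ← Finset.sum_mul]
  rw [Real.sqrt_mul (sq_nonneg _), Real.sqrt_mul (by positivity), Real.sqrt_sq (norm_nonneg _),
    Real.sqrt_sq (matNorm_nonneg j x), mul_assoc]

/-- A bounded functional is completely bounded, with the same norm. -/
theorem sum_norm_sq_dual_le {m n : Type*} [Fintype m] [Fintype n] (f : StrongDual ℂ X)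
    (x : Matrix m n X) (ξ : n → ℂ) :
    ∑ i, ‖∑ l, f (x i l) * ξ l‖ ^ 2 ≤ (‖f‖ * matNorm j x) ^ 2 * ∑ l, ‖ξ l‖ ^ 2 := by
  set v : m → ℂ := fun i => ∑ l, f (x i l) * ξ l with hv
  set S := ∑ i, ‖v i‖ ^ 2
  have hS : 0 ≤ S := by positivity
  have hT : 0 ≤ ∑ l, ‖ξ l‖ ^ 2 := by positivity
  -- Duality: pairing the vector `v` with itself turns `‖v‖²` into the value of `f` at a single
  -- element of `X`, the compression of `x` by the row `star v` and the column `ξ`. Thus the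
  -- ordinary norm of `f` suffices.
  have h1 : (S : ℂ) = f (∑ i, ∑ l, (star (v i) * ξ l) • x i l) := by
    simp only [map_sum, map_smul, smul_eq_mul, S, Complex.ofReal_sum, Complex.ofReal_pow]
    refine Finset.sum_congr rfl fun i _ => ?_
    rw [← Complex.conj_mul']
    conv_lhs => rw [hv]
    rw [Finset.mul_sum]
    exact Finset.sum_congr rfl fun l _ => by simp only [hv, starRingEnd_apply]; ring
  have h2 : S ≤ ‖f‖ * (√S * (matNorm j x * √(∑ l, ‖ξ l‖ ^ 2))) := by
    have h3 := norm_sum_smul_le_matNorm j x (fun i => star (v i)) ξ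
    simp only [norm_star] at h3
    calc S = ‖(S : ℂ)‖ := by rw [Complex.norm_real, Real.norm_of_nonneg hS]
      _ ≤ _ := by
        rw [h1]
        exact (f.le_opNorm _).trans (mul_le_mul_of_nonneg_left h3 (norm_nonneg f))
  -- The previous bound has a factor `√S` on the right, which is cancelled; the case `S = 0` is
  -- separate.
  have h4 : √S ≤ ‖f‖ * matNorm j x * √(∑ l, ‖ξ l‖ ^ 2) := by
    rcases (Real.sqrt_nonneg S).eq_or_lt with h0 | h0
    · rw [← h0]
      exact mul_nonneg (mul_nonneg (norm_nonneg _) (matNorm_nonneg j x)) (Real.sqrt_nonneg _)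
    · refine le_of_mul_le_mul_left ?_ h0
      rw [Real.mul_self_sqrt hS]
      linarith
  have h5 := pow_le_pow_left₀ (Real.sqrt_nonneg S) h4 2
  rwa [mul_pow, Real.sq_sqrt hS, Real.sq_sqrt hT] at h5

theorem matNorm_unique_le {m n : Type*} [Fintype m] [Fintype n] [Unique m] [Unique n] (a : X) :
    matNorm j (fun (_ : m) (_ : n) => a) ≤ ‖a‖ := by
  refine matNorm_le j _ (norm_nonneg a) fun ξ => ?_
  simp only [Fintype.sum_unique]
  rw [← mul_pow, ← j.norm_map a]
  exact pow_le_pow_left₀ (norm_nonneg _) ((j a).le_opNorm _) 2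

end CompletelyBounded

/-! ### Product functionals on the two tensor norms -/

section Functionals

variable {H K X Y : Type*} [NormedAddCommGroup H] [InnerProductSpace ℂ H]
  [NormedAddCommGroup K] [InnerProductSpace ℂ K]
  [NormedAddCommGroup X] [NormedSpace ℂ X] [NormedAddCommGroup Y] [NormedSpace ℂ Y]
  (j : X →ₗᵢ[ℂ] (H →L[ℂ] H)) (k : Y →ₗᵢ[ℂ] (K →L[ℂ] K))

/-- The functional `a ⊗ b ↦ f a * g b` on the algebraic tensor product. -/
def dualTensor (f : StrongDual ℂ X) (g : StrongDual ℂ Y) : X ⊗[ℂ] Y →ₗ[ℂ] ℂ :=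
  LinearMap.mul' ℂ ℂ ∘ₗ TensorProduct.map f.toLinearMap g.toLinearMap

theorem dualTensor_tmul (f : StrongDual ℂ X) (g : StrongDual ℂ Y) (a : X) (b : Y) :
    dualTensor f g (a ⊗ₜ b) = f a * g b := rfl

/-- On `rowCol x y` the functional is the scalar row `f (x 0 l)` times the scalar column `g (y l
0)`. Complete boundedness of `f` and `g` bounds the two factors separately. -/
theorem norm_dualTensor_le_haagerupNorm (f : StrongDual ℂ X) (g : StrongDual ℂ Y)
    (u : X ⊗[ℂ] Y) : ‖dualTensor f g u‖ ≤ ‖f‖ * ‖g‖ * haagerupNorm j k u := by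
  refine le_of_forall_pos_le_add fun ε hε => ?_
  obtain ⟨δ, hδ, hδε⟩ : ∃ δ : ℝ, 0 < δ ∧ ‖f‖ * ‖g‖ * δ ≤ ε :=
    -- The summand `1` keeps the denominator positive when `f` or `g` vanishes.
    ⟨ε / (‖f‖ * ‖g‖ + 1), by positivity, by
      rw [← mul_div_assoc, div_le_iff₀ (by positivity)]; nlinarith⟩
  obtain ⟨r, x, y, hu, hxy⟩ := exists_rowCol_lt j k (lt_add_of_pos_right (haagerupNorm j k u) hδ)
  have hy : √(∑ l, ‖g (y l 0)‖ ^ 2) ≤ ‖g‖ * matNorm k y := by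
    refine Real.sqrt_le_iff.2 ⟨mul_nonneg (norm_nonneg g) (matNorm_nonneg k y), ?_⟩
    -- The column is the image of the scalar `1` under the one-column matrix `g (y l 0)`.
    simpa using sum_norm_sq_dual_le k g y fun _ => 1
  have hx : ‖∑ l, f (x 0 l) * g (y l 0)‖ ≤ ‖f‖ * matNorm j x * √(∑ l, ‖g (y l 0)‖ ^ 2) := by
    refine le_of_sq_le_sq ?_ (mul_nonneg (mul_nonneg (norm_nonneg f) (matNorm_nonneg j x))
      (Real.sqrt_nonneg _))
    rw [mul_pow _ (√_), Real.sq_sqrt (by positivity)]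
    simpa using sum_norm_sq_dual_le j f x fun l => g (y l 0)
  calc ‖dualTensor f g u‖ = ‖∑ l, f (x 0 l) * g (y l 0)‖ := by
        simp [hu, rowCol, dualTensor_tmul]
    _ ≤ ‖f‖ * matNorm j x * (‖g‖ * matNorm k y) := hx.trans <| mul_le_mul_of_nonneg_left hy
        (mul_nonneg (norm_nonneg f) (matNorm_nonneg j x))
    _ = ‖f‖ * ‖g‖ * (matNorm j x * matNorm k y) := by ring
    _ ≤ ‖f‖ * ‖g‖ * (haagerupNorm j k u + δ) := by gcongr
    _ ≤ _ := by rw [mul_add]; gcongr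

/-- The scalar matrix `f (x) ⊗ g (y)` factors as `(f (x) ⊗ 1) (1 ⊗ g (y))`. Each factor acts on one
index while the other is held fixed, so its norm is that of `f (x)` or `g (y)` alone. -/
theorem norm_dualTensor_contract_le {m n p q : Type*} [Fintype m] [Fintype n] [Fintype p]
    [Fintype q] (f : StrongDual ℂ X) (g : StrongDual ℂ Y) (α : EuclideanSpace ℂ (m × p))
    (x : Matrix m n X) (y : Matrix p q Y) (β : EuclideanSpace ℂ (n × q)) :
    ‖dualTensor f g (contract α x y β)‖ ≤
      ‖f‖ * ‖g‖ * (‖α‖ * matNorm j x * matNorm k y * ‖β‖) := by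
  -- This is `(1 ⊗ g (y)) β`, with the row index of `y` written first.
  set w : p → n → ℂ := fun s l => ∑ t, g (y s t) * β (l, t) with hw
  have h1 : dualTensor f g (contract α x y β) =
      ∑ r : m × p, α r * ∑ l, f (x r.1 l) * w r.2 l := by
    simp only [contract, map_sum, map_smul, dualTensor_tmul, smul_eq_mul, hw]
    refine Finset.sum_congr rfl fun r _ => ?_
    simp only [Fintype.sum_prod_type, Finset.mul_sum]
    exact Finset.sum_congr rfl fun l _ => Finset.sum_congr rfl fun t _ => by ring
  have h2 : ∑ r : m × p, ‖∑ l, f (x r.1 l) * w r.2 l‖ ^ 2 ≤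
      (‖f‖ * matNorm j x * (‖g‖ * matNorm k y) * ‖β‖) ^ 2 := by
    rw [Fintype.sum_prod_type, Finset.sum_comm, mul_pow, mul_pow, mul_assoc,
      EuclideanSpace.norm_sq_eq, Fintype.sum_prod_type]
    -- The matrix `f (x)` acts for each fixed row index `s` of `y`; afterwards `g (y)` acts for each
    -- fixed column index `l` of `x`.
    refine (Finset.sum_le_sum fun s _ => sum_norm_sq_dual_le j f x (w s)).trans ?_
    rw [← Finset.mul_sum, Finset.sum_comm]
    refine mul_le_mul_of_nonneg_left ?_ (sq_nonneg _)
    rw [Finset.mul_sum]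
    exact Finset.sum_le_sum fun l _ => sum_norm_sq_dual_le k g y fun t => β (l, t)
  have hx := matNorm_nonneg j x
  have hy := matNorm_nonneg k y
  rw [h1]
  calc ‖∑ r : m × p, α r * ∑ l, f (x r.1 l) * w r.2 l‖
      ≤ ∑ r : m × p, ‖α r‖ * ‖∑ l, f (x r.1 l) * w r.2 l‖ :=
        (norm_sum_le _ _).trans_eq (by simp only [norm_mul])
    _ ≤ _ := Real.sum_mul_le_sqrt_mul_sqrt _ _ _
    _ ≤ ‖α‖ * (‖f‖ * matNorm j x * (‖g‖ * matNorm k y) * ‖β‖) := by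
        rw [← EuclideanSpace.norm_eq]
        exact mul_le_mul_of_nonneg_left (Real.sqrt_le_iff.2 ⟨by positivity, h2⟩) (norm_nonneg α)
    _ = _ := by ring

theorem norm_dualTensor_le_projNorm (f : StrongDual ℂ X) (g : StrongDual ℂ Y)
    (u : X ⊗[ℂ] Y) : ‖dualTensor f g u‖ ≤ ‖f‖ * ‖g‖ * projNorm j k u := by
  refine le_of_forall_pos_le_add fun ε hε => ?_
  obtain ⟨δ, hδ, hδε⟩ : ∃ δ : ℝ, 0 < δ ∧ ‖f‖ * ‖g‖ * δ ≤ ε :=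
    ⟨ε / (‖f‖ * ‖g‖ + 1), by positivity, by
      rw [← mul_div_assoc, div_le_iff₀ (by positivity)]; nlinarith⟩
  obtain ⟨p, q, α, x, y, β, hu, hs⟩ :=
    exists_contract_lt j k (lt_add_of_pos_right (projNorm j k u) hδ)
  calc ‖dualTensor f g u‖ ≤ ‖f‖ * ‖g‖ * (‖α‖ * matNorm j x * matNorm k y * ‖β‖) := by
        rw [hu]; exact norm_dualTensor_contract_le j k f g α x y β
    _ ≤ ‖f‖ * ‖g‖ * (projNorm j k u + δ) := by gcongr
    _ ≤ _ := by rw [mul_add]; gcongr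

/-- This half of the cross-norm identity is enough: it makes `a ↦ a ⊗ b` and `b ↦ a ⊗ b` bounded. -/
theorem haagerupNorm_tmul_le (a : X) (b : Y) : haagerupNorm j k (a ⊗ₜ b) ≤ ‖a‖ * ‖b‖ := by
  have h := haagerupNorm_rowCol_le j k (fun (_ : Fin 1) (_ : Fin 1) => a)
    (fun (_ : Fin 1) (_ : Fin 1) => b)
  simp only [rowCol, Fintype.sum_unique] at h
  exact h.trans <| mul_le_mul (matNorm_unique_le j a) (matNorm_unique_le k b)
    (matNorm_nonneg k _) (norm_nonneg a)

theorem projNorm_tmul_le (a : X) (b : Y) : projNorm j k (a ⊗ₜ b) ≤ ‖a‖ * ‖b‖ := by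
  let e : EuclideanSpace ℂ (Fin 1 × Fin 1) := WithLp.toLp 2 fun _ => 1
  have he : ‖e‖ = 1 := by simp [e, EuclideanSpace.norm_eq]
  have h := projNorm_contract_le j k e (fun (_ : Fin 1) (_ : Fin 1) => a)
    (fun (_ : Fin 1) (_ : Fin 1) => b) e
  rw [he, one_mul, mul_one] at h
  simp only [contract, e, mul_one, one_smul] at h
  exact h.trans <| mul_le_mul (matNorm_unique_le j a) (matNorm_unique_le k b)
    (matNorm_nonneg k _) (norm_nonneg a)

end Functionals

/-! ### Transfer of Arens regularity -/

section ArensTransfer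

variable {A B C : Type*} [NonUnitalNormedRing A] [NormedSpace ℂ A] [IsScalarTower ℂ A A]
  [SMulCommClass ℂ A A] [NonUnitalNormedRing B] [NormedSpace ℂ B]
  [NonUnitalNormedRing C] [NormedSpace ℂ C] [IsScalarTower ℂ C C] [SMulCommClass ℂ C C]

/-- Arens regularity passes to `A` when every functional `f (a * b)` on `A × A` is of the form
`φ (S a * T b)` for a functional `φ` on an Arens regular algebra. -/
theorem IsArensRegular.of_factor (S T : A →L[ℂ] C)
    (h : ∀ f : StrongDual ℂ A, ∃ φ : StrongDual ℂ C, ∀ a b, φ (S a * T b) = f (a * b))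
    (hC : IsArensRegular C) : IsArensRegular A := by
  intro F G
  ext f
  obtain ⟨φ, hφ⟩ := h f
  -- The adjoint of `U`, so that `F ∘L pre S` and `G ∘L pre T` are the images of `F` and `G` under
  -- the second adjoints of `S` and `T`.
  let pre (U : A →L[ℂ] C) : StrongDual ℂ C →L[ℂ] StrongDual ℂ A :=
    (ContinuousLinearMap.compL ℂ A C ℂ).flip U
  have key := congrArg (fun Φ => Φ φ) (hC (F ∘L pre S) (G ∘L pre T))
  -- Unfolding leaves `φ` evaluated only at the products `S a * T b`. In both Arens products `F`
  -- takes the left factor, so the same pair `S`, `T` serves for `h1` and `h2`.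
  have h1 : arensFst (F ∘L pre S) (G ∘L pre T) φ = arensFst F G f := by
    rw [arensFst_apply, arensFst_apply]
    refine congrArg F (ContinuousLinearMap.ext fun a => congrArg G ?_)
    ext b
    exact hφ a b
  have h2 : arensSnd (F ∘L pre S) (G ∘L pre T) φ = arensSnd F G f := by
    rw [arensSnd_apply, arensSnd_apply]
    refine congrArg G (ContinuousLinearMap.ext fun b => congrArg F ?_)
    ext a
    exact hφ a b
  exact h1.symm.trans (key.trans h2)

theorem exists_dual_eq_one {b : B} (hb : b ≠ 0) : ∃ g : StrongDual ℂ B, g b = 1 := by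
  obtain ⟨g, -, hg⟩ := exists_dual_vector ℂ b (norm_ne_zero_iff.2 hb)
  refine ⟨((‖b‖ : ℂ))⁻¹ • g, ?_⟩
  have : (‖b‖ : ℂ) ≠ 0 := by simpa using hb
  rw [smul_apply, hg]
  exact inv_mul_cancel₀ this

/-- The map `τ` stands for `(a, b) ↦ a ⊗ b`. Only these properties of a tensor product matter, and
they are symmetric in the two factors, so the statement covers both norms and, after a flip, both
algebras. -/
theorem IsArensRegular.left_of_bilin (τ : A →ₗ[ℂ] B →ₗ[ℂ] C)
    (hτ : ∀ a b, ‖τ a b‖ ≤ ‖a‖ * ‖b‖)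
    (hmul : ∀ a b a' b', τ a b * τ a' b' = τ (a * a') (b * b'))
    (hdual : ∀ (f : StrongDual ℂ A) (g : StrongDual ℂ B), ∃ φ : StrongDual ℂ C,
      ∀ a b, φ (τ a b) = f a * g b)
    (hB : ∃ b b' : B, b * b' ≠ 0) (hC : IsArensRegular C) : IsArensRegular A := by
  obtain ⟨b, b', hb⟩ := hB
  obtain ⟨g, hg⟩ := exists_dual_eq_one hb
  let τ' := τ.mkContinuous₂ 1 fun a b => by simpa using hτ a b
  -- The two maps use the different elements `b` and `b'`, so that their product carries `b * b'`,
  -- where `g` equals `1`.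
  refine hC.of_factor (τ'.flip b) (τ'.flip b') fun f => ?_
  obtain ⟨φ, hφ⟩ := hdual f g
  refine ⟨φ, fun a a' => ?_⟩
  change φ (τ a b * τ a' b') = _
  rw [hmul, hφ, hg, mul_one]

end ArensTransfer

/-! ### Passage to the completion -/

theorem exists_dual_algCompletion {R : Type*} [NonUnitalSeminormedRing R] [NormedSpace ℂ R]
    (φ : R →L[ℂ] ℂ) :
    ∃ ψ : StrongDual ℂ (AlgCompletion R), ∀ u, ψ (toAlgCompletion u) = φ u :=
  ⟨φ.extend (UniformSpace.Completion.toComplL : R →L[ℂ] UniformSpace.Completion R),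
    fun u => φ.extend_eq (UniformSpace.Completion.denseRange_coe)
      (UniformSpace.Completion.isUniformInducing_coe R) u⟩

section CompletionTransfer

variable {A B R : Type*} [NonUnitalNormedRing A] [NormedSpace ℂ A] [IsScalarTower ℂ A A]
  [SMulCommClass ℂ A A] [NonUnitalNormedRing B] [NormedSpace ℂ B] [IsScalarTower ℂ B B]
  [SMulCommClass ℂ B B]
  [NonUnitalSeminormedRing R] [NormedSpace ℂ R] [IsScalarTower ℂ R R] [SMulCommClass ℂ R R]

variable (R) in
/-- The canonical map of a seminormed algebra to its completion, as a linear map. -/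
def toAlgCompletionₗ : R →ₗ[ℂ] AlgCompletion R where
  toFun := toAlgCompletion
  map_add' := toAlgCompletion_add
  map_smul' := toAlgCompletion_smul

/-- All data may be checked on the algebraic level: the canonical map to the completion is
multiplicative and isometric, and bounded functionals extend along it by density. A seminorm on `R`
suffices, so definiteness of the tensor norms plays no role. -/
theorem IsArensRegular.of_algCompletion (τ : A →ₗ[ℂ] B →ₗ[ℂ] R)
    (hτ : ∀ a b, ‖τ a b‖ ≤ ‖a‖ * ‖b‖)
    (hmul : ∀ a b a' b', τ a b * τ a' b' = τ (a * a') (b * b'))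
    (hdual : ∀ (f : StrongDual ℂ A) (g : StrongDual ℂ B), ∃ φ : R →L[ℂ] ℂ,
      ∀ a b, φ (τ a b) = f a * g b)
    (hA : ∃ a a' : A, a * a' ≠ 0) (hB : ∃ b b' : B, b * b' ≠ 0)
    (hC : IsArensRegular (AlgCompletion R)) : IsArensRegular A ∧ IsArensRegular B := by
  let σ : A →ₗ[ℂ] B →ₗ[ℂ] AlgCompletion R := τ.compr₂ (toAlgCompletionₗ R)
  have hσ : ∀ a b, ‖σ a b‖ ≤ ‖a‖ * ‖b‖ := fun a b =>
    (norm_toAlgCompletion (τ a b)).trans_le (hτ a b)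
  have hσmul : ∀ a b a' b', σ a b * σ a' b' = σ (a * a') (b * b') := fun a b a' b' =>
    (toAlgCompletion_mul (τ a b) (τ a' b')).symm.trans (congrArg toAlgCompletion (hmul a b a' b'))
  have hσdual : ∀ (f : StrongDual ℂ A) (g : StrongDual ℂ B),
      ∃ φ : StrongDual ℂ (AlgCompletion R), ∀ a b, φ (σ a b) = f a * g b := fun f g => by
    obtain ⟨φ, hφ⟩ := hdual f g
    obtain ⟨ψ, hψ⟩ := exists_dual_algCompletion φ
    exact ⟨ψ, fun a b => (hψ (τ a b)).trans (hφ a b)⟩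
  -- Regularity of each algebra uses a nonzero product in the other one: `hB` for `A`, and `hA` for
  -- `B` through the flipped map.
  refine ⟨hC.left_of_bilin σ hσ hσmul hσdual hB, hC.left_of_bilin σ.flip
    (fun b a => (hσ a b).trans_eq (mul_comm _ _)) (fun b a b' a' => hσmul a b a' b')
    (fun g f => ?_) hA⟩
  obtain ⟨φ, hφ⟩ := hσdual f g
  exact ⟨φ, fun b a => (hφ a b).trans (mul_comm _ _)⟩

end CompletionTransfer

end OperatorSpace

end

/-! ### The projective and Haagerup tensor products -/

theorem mainTheorem8
    {H K : Type*} [NormedAddCommGroup H] [InnerProductSpace ℂ H] [CompleteSpace H]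
    [NormedAddCommGroup K] [InnerProductSpace ℂ K] [CompleteSpace K]
    {A B : Type*} [NonUnitalNormedRing A] [NormedSpace ℂ A] [IsScalarTower ℂ A A]
    [SMulCommClass ℂ A A] [CompleteSpace A]
    [NonUnitalNormedRing B] [NormedSpace ℂ B] [IsScalarTower ℂ B B]
    [SMulCommClass ℂ B B] [CompleteSpace B]
    (j : A →ₗᵢ[ℂ] (H →L[ℂ] H)) (k : B →ₗᵢ[ℂ] (K →L[ℂ] K))
    [OperatorSpace.IsCompletelyContractiveAlgebra j]
    [OperatorSpace.IsCompletelyContractiveAlgebra k]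
    (hA : ∃ a a' : A, a * a' ≠ 0) (hB : ∃ b b' : B, b * b' ≠ 0) :
    (OperatorSpace.IsArensRegular (OperatorSpace.ProjTensor j k) →
      OperatorSpace.IsArensRegular A ∧ OperatorSpace.IsArensRegular B) ∧
    (OperatorSpace.IsArensRegular (OperatorSpace.HaagerupTensor j k) →
      OperatorSpace.IsArensRegular A ∧ OperatorSpace.IsArensRegular B) := by
  refine ⟨OperatorSpace.IsArensRegular.of_algCompletion (R := OperatorSpace.AlgProj j k)
      (TensorProduct.mk ℂ A B) (OperatorSpace.projNorm_tmul_le j k) (fun a b a' b' =>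
        Algebra.TensorProduct.tmul_mul_tmul a a' b b') (fun f g => ?_) hA hB,
    OperatorSpace.IsArensRegular.of_algCompletion (R := OperatorSpace.AlgHaagerup j k)
      (TensorProduct.mk ℂ A B) (OperatorSpace.haagerupNorm_tmul_le j k) (fun a b a' b' =>
        Algebra.TensorProduct.tmul_mul_tmul a a' b b') (fun f g => ?_) hA hB⟩
  -- The functional `f ⊗ g`, regarded on the algebraic tensor product with the projective norm, is
  -- continuous with bound `‖f‖ * ‖g‖`; the Haagerup case below is parallel.
  · let φ : OperatorSpace.AlgProj j k →ₗ[ℂ] ℂ := OperatorSpace.dualTensor f g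
    exact ⟨φ.mkContinuous (‖f‖ * ‖g‖) (OperatorSpace.norm_dualTensor_le_projNorm j k f g),
      fun a b => rfl⟩
  · let φ : OperatorSpace.AlgHaagerup j k →ₗ[ℂ] ℂ := OperatorSpace.dualTensor f g
    exact ⟨φ.mkContinuous (‖f‖ * ‖g‖) (OperatorSpace.norm_dualTensor_le_haagerupNorm j k f g),
      fun a b => rfl⟩
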